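/- Let $\mathbb K\in\{\mathbb R,\mathbb C\}$. Lie groups are groups which are smooth manifolds modelled on Hausdorff locally convex $\mathbb K$-spaces with smooth multiplication and inversion; a map $f$ is $C^1$ if it is continuous and its directional derivatives exist and define a continuous map $(x,h)\mapsto df(x)(h)$, it is $C^{n+1}$ if it is $C^1$ and $df$ is $C^n$, and smooth if it is $C^n$ for all $n$. A subgroup $H$ of a Lie group $P$ is a split Lie subgroup if it carries a Lie group structure and $P/H$ a manifold structure for which $P\to P/H$ is a (locally trivial) smooth $H$-principal bundle. A Lie group extension of $G$ by $N$ is a short exact sequence $1\to N\to\widehat G\to G\to 1$ of Lie group morphisms which is a smooth $N$-principal bundle over $G$; two extensions are equivalent if there is a Lie group morphism between them inducing the identity on $N$ and on $G$. Let $G,N$ be Lie groups. Let $C^p_s(G,N)$ be the set of maps $G^p\to N$ which are smooth in an identity neighbourhood and take the value $1$ whenever one argument is $1$, and let $C^2_{ss}(G,N)$ be the set of those $\omega\in C^2_s(G,N)$ for which, for every $g\in G$, the map $x\mapsto\omega(g,x)\,\omega(gxg^{-1},g)^{-1}$ is smooth in an identity neighbourhood. Write $C_N(n)(m)=nmn^{-1}$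 and $\delta_f(g,g')=f(g)f(g')f(gg')^{-1}$. A smooth outer action of $G$ on $N$ is a map $S:G\to\mathrm{Aut}(N)$ into the group of Lie group automorphisms, with $S(1)=\mathrm{id}_N$, such that $(g,n)\mapsto S(g)(n)$ is smooth on $U\times N$ for an open identity neighbourhood $U\subseteq G$, and such that $\delta_S=C_N\circ\omega$ for some $\omega\in C^2_s(G,N)$; it is strongly smooth if $\omega$ can be chosen in $C^2_{ss}(G,N)$. Put $S\sim S'$ if $S'=(C_N\circ h)\cdot S$ for some $h\in C^1_s(G,N)$; $[S]$ denotes the class of $S$. A smooth crossed module is a Lie group morphism $\alpha:H\to P$ with a smooth action of $P$ on $H$ by automorphisms such that $\alpha(p.h)=p\,\alpha(h)\,p^{-1}$ and $\alpha(h).h'=hh'h^{-1}$, such that $\ker\alpha\le H$ and $\operatorname{im}\alpha\le P$ are split Lie subgroups and $\alpha$ induces an isomorphism of Lie groups $H/\ker\alpha\to\operatorname{im}\alpha$. **Lemma.** Assume that the center $Z(N)$ is a split Lie subgroup of $N$, and let $S$ be a strongly smooth outer action of $G$ on $N$. Then $N_{\rm ad}:=N/Z(N)$, whose elements we write as $C_N(n)$,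 is a Lie group with the quotient manifold structure, and $G^S:=N_{\rm ad}\times G$ is a group with the product $$(C_N(n),g)(C_N(n'),g')=\big(C_N(n\,S(g)(n')\,\omega(g,g')),\,gg'\big),$$ which is the same for all $\omega:G\times G\to N$ with $\delta_S=C_N\circ\omega$. Moreover: 1. $G^S$ carries a Lie group structure, unique up to the identity being a diffeomorphism, for which, for some open identity neighbourhood $U\subseteq G$, the set $N_{\rm ad}\times U$ is open in $G^S$ and carries the product manifold structure. With it, $q_S:G^S\to G$, $(C_N(n),g)\mapsto g$, is a Lie group extension of $G$ by $N_{\rm ad}$ (included by $a\mapsto(a,1)$). The equivalence class of this extension depends only on $[S]$: every smooth outer action $S'\sim S$ is strongly smooth, and $G^{S'}$ and $G^S$ are equivalent extensions of $G$ by $N_{\rm ad}$. 2. $\rho:G^S\to\mathrm{Aut}(N)$, $\rho(C_N(n),g)=C_N(n)S(g)$, is a homomorphism defining a smooth action of $G^S$ on $N$. 3. $\alpha:N\to G^S$, $n\mapsto(C_N(n),1)$, with the action $\rho$, is a smooth crossed module with $\ker\alpha=Z(N)$ and image $N_{\rm ad}\times\{1\}$, and $q_S$ induces an isomorphism of Lie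 groups $\operatorname{coker}\alpha=G^S/N_{\rm ad}\cong G$. The map $S$ is the corresponding strongly smooth outer action of $G$ on $N$: there is a section $\sigma\in C^1_s(G,G^S)$ of $q_S$ with $\rho\circ\sigma=S$, and an $\omega\in C^2_{ss}(G,N)$ with $\alpha\circ\omega=\delta_\sigma$ and $\delta_S=C_N\circ\omega$. -/

import Mathlib

open Filter Topology Set

universe u₁ u₂ u₃ u₄ v

/-! ## Differential calculus on locally convex spaces -/

/-- `CnOn 𝕜 n f U`: the map `f` between topological vector spaces is of class `C^n` on the open
set `U`. It is `C^0` if it is continuous, and `C^(n+1)` if it is continuous, all directional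
derivatives `df(x)(h) = lim_{t → 0} t⁻¹ (f (x + t h) - f x)`, for `x` in `U`, exist, and the map
`(x, h) ↦ df(x)(h)` is of class `C^n` on `U × E`. -/
def CnOn (𝕜 : Type u₁) [RCLike 𝕜] : ℕ → ∀ {E : Type u₂} {F : Type u₃}
    [AddCommGroup E] [Module 𝕜 E] [TopologicalSpace E]
    [AddCommGroup F] [Module 𝕜 F] [TopologicalSpace F], (E → F) → Set E → Prop
  | 0, _, _, _, _, _, _, _, _, f, U => ContinuousOn f U
  | n + 1, E, F, _, _, _, _, _, _, f, U =>
      ContinuousOn f U ∧ ∃ df : E × E → F,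
        (∀ x ∈ U, ∀ h : E,
          Tendsto (fun t : 𝕜 => t⁻¹ • (f (x + t • h) - f x)) (𝓝[≠] 0) (𝓝 (df (x, h)))) ∧
        CnOn 𝕜 n df (U ×ˢ univ)

section Calculus

variable {𝕜 : Type u₁} [RCLike 𝕜]
  {E : Type u₂} [AddCommGroup E] [Module 𝕜 E] [TopologicalSpace E]
  {F : Type u₃} [AddCommGroup F] [Module 𝕜 F] [TopologicalSpace F]

theorem CnOn.continuousOn {n : ℕ} {f : E → F} {U : Set E} (h : CnOn 𝕜 n f U) :
    ContinuousOn f U := by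
  cases n with
  | zero => exact h
  | succ n => exact h.1

theorem CnOn.mono {n : ℕ} {f : E → F} {U V : Set E} (h : CnOn 𝕜 n f U) (hVU : V ⊆ U) :
    CnOn 𝕜 n f V := by
  induction n generalizing E F with
  | zero => exact ContinuousOn.mono h hVU
  | succ n ih =>
    obtain ⟨hc, df, hd, hs⟩ := h
    exact ⟨hc.mono hVU, df, fun x hx => hd x (hVU hx), ih hs (prod_mono hVU subset_rfl)⟩

theorem CnOn.comp_linear {E' : Type u₄} [AddCommGroup E'] [Module 𝕜 E'] [TopologicalSpace E']
    {n : ℕ} {f : E → F} {U : Set E} (h : CnOn 𝕜 n f U) (L : E' →L[𝕜] E) :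
    CnOn 𝕜 n (fun x => f (L x)) (L ⁻¹' U) := by
  induction n generalizing E E' F with
  | zero => exact ContinuousOn.comp h L.continuous.continuousOn (mapsTo_preimage _ _)
  | succ n ih =>
    obtain ⟨hc, df, hd, hs⟩ := h
    refine ⟨hc.comp L.continuous.continuousOn (mapsTo_preimage _ _),
      fun p => df (L p.1, L p.2), fun x hx k => ?_, ?_⟩
    · simpa using hd (L x) hx (L k)
    · refine (ih hs (L.prodMap L)).mono ?_
      rintro ⟨x, k⟩ ⟨hx, -⟩
      exact ⟨hx, mem_univ _⟩

theorem CnOn.prodMk {F' : Type u₄} [AddCommGroup F'] [Module 𝕜 F'] [TopologicalSpace F']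
    {n : ℕ} {f : E → F} {g : E → F'} {U : Set E} (hf : CnOn 𝕜 n f U) (hg : CnOn 𝕜 n g U) :
    CnOn 𝕜 n (fun x => (f x, g x)) U := by
  induction n generalizing E F F' with
  | zero => exact ContinuousOn.prodMk hf hg
  | succ n ih =>
    obtain ⟨hc, df, hd, hs⟩ := hf
    obtain ⟨hc', dg, hd', hs'⟩ := hg
    exact ⟨hc.prodMk hc', fun p => (df p, dg p),
      fun x hx k => (hd x hx k).prodMk_nhds (hd' x hx k), ih hs hs'⟩

end Calculus

/-- `f` is smooth on the open set `U`, i.e. of class `C^n` on `U` for all `n`. -/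
def SmoothOnOpen (𝕜 : Type u₁) [RCLike 𝕜] {E : Type u₂} {F : Type u₃}
    [AddCommGroup E] [Module 𝕜 E] [TopologicalSpace E]
    [AddCommGroup F] [Module 𝕜 F] [TopologicalSpace F] (f : E → F) (U : Set E) : Prop :=
  ∀ n : ℕ, CnOn 𝕜 n f U

/-! ## Manifolds modelled on locally convex spaces -/

/-- A smooth manifold structure on the set `M`: a Hausdorff topology together with an atlas of
charts with values in a Hausdorff locally convex space over `𝕜`, with smooth chart changes. -/
structure LCManifold (𝕜 : Type u₁) [RCLike 𝕜] (M : Type u₂) where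
  /-- the locally convex model space -/
  Model : Type v
  [addCommGroup : AddCommGroup Model]
  [module : Module 𝕜 Model]
  [modelTop : TopologicalSpace Model]
  [topAddGroup : IsTopologicalAddGroup Model]
  [continuousSMul : ContinuousSMul 𝕜 Model]
  [modelT2 : T2Space Model]
  [locallyConvex : PolynormableSpace 𝕜 Model]
  [top : TopologicalSpace M]
  [t2 : T2Space M]
  [charted : ChartedSpace Model M]
  smooth_change : ∀ e ∈ atlas Model M, ∀ e' ∈ atlas Model M,
    SmoothOnOpen 𝕜 (fun x => e' (e.symm x)) (e.symm.trans e').source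

attribute [instance] LCManifold.addCommGroup LCManifold.module LCManifold.modelTop
  LCManifold.topAddGroup LCManifold.continuousSMul LCManifold.modelT2 LCManifold.locallyConvex

namespace LCManifold

variable {𝕜 : Type u₁} [RCLike 𝕜]

/-- Openness in the topology of the manifold. -/
def IsOpenSet {M : Type u₂} (A : LCManifold.{u₁, u₂, v} 𝕜 M) (U : Set M) : Prop :=
  letI := A.top
  IsOpen U

/-- `f` is smooth on the open subset `U` of `M`: it is continuous there, and smooth in charts. -/
def SmoothOn {M : Type u₂} {M' : Type u₃} (A : LCManifold.{u₁, u₂, v} 𝕜 M)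
    (B : LCManifold.{u₁, u₃, v} 𝕜 M') (f : M → M') (U : Set M) : Prop :=
  letI := A.top
  letI := B.top
  letI := A.charted
  letI := B.charted
  ContinuousOn f U ∧ ∀ e ∈ atlas A.Model M, ∀ e' ∈ atlas B.Model M',
    SmoothOnOpen 𝕜 (fun x => e' (f (e.symm x)))
      (e.target ∩ e.symm ⁻¹' (U ∩ f ⁻¹' e'.source))

/-- Smooth maps between manifolds. -/
def Smooth {M : Type u₂} {M' : Type u₃} (A : LCManifold.{u₁, u₂, v} 𝕜 M)
    (B : LCManifold.{u₁, u₃, v} 𝕜 M') (f : M → M') : Prop :=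
  A.SmoothOn B f univ

/-- The bijection `e` is a diffeomorphism. -/
def Diffeo {M : Type u₂} {M' : Type u₃} (A : LCManifold.{u₁, u₂, v} 𝕜 M)
    (B : LCManifold.{u₁, u₃, v} 𝕜 M') (e : M ≃ M') : Prop :=
  A.Smooth B e ∧ B.Smooth A e.symm

/-- The product manifold. -/
def prod {M : Type u₂} {M' : Type u₃} (A : LCManifold.{u₁, u₂, v} 𝕜 M)
    (B : LCManifold.{u₁, u₃, v} 𝕜 M') : LCManifold.{u₁, max u₂ u₃, v} 𝕜 (M × M') :=
  letI := A.top
  letI := B.top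
  letI := A.t2
  letI := B.t2
  letI := A.charted
  letI := B.charted
  { Model := A.Model × B.Model
    charted := prodChartedSpace A.Model M B.Model M'
    smooth_change := by
      rintro _ ⟨a, ha, b, hb, rfl⟩ _ ⟨a', ha', b', hb', rfl⟩ n
      have h₁ := (A.smooth_change a ha a' ha' n).comp_linear
        (ContinuousLinearMap.fst 𝕜 A.Model B.Model)
      have h₂ := (B.smooth_change b hb b' hb' n).comp_linear
        (ContinuousLinearMap.snd 𝕜 A.Model B.Model)
      refine (h₁.mono ?_).prodMk (h₂.mono ?_)
      · rintro ⟨x, y⟩ ⟨hx, hx'⟩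
        exact ⟨hx.1, hx'.1⟩
      · rintro ⟨x, y⟩ ⟨hx, hx'⟩
        exact ⟨hx.2, hx'.2⟩ }

/-- The manifold structure turns the group `G` into a Lie group. -/
structure IsLieGroup {G : Type u₂} [Group G] (A : LCManifold.{u₁, u₂, v} 𝕜 G) : Prop where
  smooth_mul : (A.prod A).Smooth A (fun p => p.1 * p.2)
  smooth_inv : A.Smooth A (fun x => x⁻¹)

end LCManifold

section LieGroups

variable {𝕜 : Type u₁} [RCLike 𝕜]

/-! ## Split Lie subgroups and extensions -/

/-- For a homomorphism `i : H → P`, the right action `p.h = p * i h` of the Lie group `H` on `P`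
makes `π : P → X` a smooth `H`-principal bundle: `i` and `π` are smooth, the action is free, its
orbits are the fibres of `π`, and `π` is locally trivial: over small open sets `V` there is a smooth
section `s`, and the inverse `p ↦ (π p, d p)` of the trivialization `(x, h) ↦ s x * i h` of
`π ⁻¹ V` is smooth. -/
structure IsPrincipalBundle {H : Type u₂} [Group H] {P : Type u₃} [Group P] {X : Type u₄}
    (A : LCManifold.{u₁, u₂, v} 𝕜 H) (B : LCManifold.{u₁, u₃, v} 𝕜 P)
    (C : LCManifold.{u₁, u₄, v} 𝕜 X) (i : H →* P) (π : P → X) : Prop where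
  smooth_incl : A.Smooth B i
  smooth_proj : B.Smooth C π
  free : Function.Injective i
  fiber : ∀ p p' : P, π p = π p' ↔ ∃ h : H, p' = p * i h
  locally_trivial : ∀ x : X, ∃ V : Set X, C.IsOpenSet V ∧ x ∈ V ∧
    ∃ s : X → P, C.SmoothOn B s V ∧ (∀ y ∈ V, π (s y) = y) ∧
    ∃ d : P → H, B.SmoothOn A d (π ⁻¹' V) ∧ ∀ p : P, π p ∈ V → p = s (π p) * i (d p)

/-- The data making the subgroup `H` of the Lie group `G` a split Lie subgroup: a Lie group
structure on `H` and a manifold structure on the coset space `G ⧸ H` for which the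
quotient map `G → G ⧸ H` is a smooth `H`-principal bundle. Both structures are unique. -/
structure SplitLieSubgroup {G : Type u₂} [Group G] (A : LCManifold.{u₁, u₂, v} 𝕜 G)
    (H : Subgroup G) where
  sub : LCManifold.{u₁, u₂, v} 𝕜 H
  sub_lie : sub.IsLieGroup
  quot : LCManifold.{u₁, u₂, v} 𝕜 (G ⧸ H)
  bundle : IsPrincipalBundle sub A quot H.subtype (fun g => (g : G ⧸ H))

/-- `1 → N → P → G → 1`, with maps `i` and `q`, is an extension of Lie groups. Exactness at `N` and
`P` is contained in the fields `free` and `fiber` of `bundle`, and surjectivity of `q` in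
`locally_trivial`. -/
structure IsLieExtension {N : Type u₂} [Group N] {P : Type u₃} [Group P] {G : Type u₄} [Group G]
    (A : LCManifold.{u₁, u₂, v} 𝕜 N) (B : LCManifold.{u₁, u₃, v} 𝕜 P)
    (C : LCManifold.{u₁, u₄, v} 𝕜 G) (i : N →* P) (q : P →* G) : Prop where
  lie_kernel : A.IsLieGroup
  lie_total : B.IsLieGroup
  lie_base : C.IsLieGroup
  bundle : IsPrincipalBundle A B C i q

/-- Two extensions `N → P → G` and `N → P' → G` are equivalent: there is a morphism of Lie groups
`P → P'` compatible with the identities of `N` and `G`. -/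
def ExtensionEquivalent {N : Type u₂} [Group N] {P P' : Type u₃} [Group P] [Group P']
    {G : Type u₄} [Group G]
    (B : LCManifold.{u₁, u₃, v} 𝕜 P) (B' : LCManifold.{u₁, u₃, v} 𝕜 P')
    (i : N →* P) (q : P →* G) (i' : N →* P') (q' : P' →* G) : Prop :=
  ∃ φ : P →* P', B.Smooth B' φ ∧ (∀ n, φ (i n) = i' n) ∧ ∀ p, q' (φ p) = q p

/-! ## Automorphisms, actions, crossed modules -/

/-- `φ` is an automorphism of the Lie group `N`. -/
def IsLieAut {N : Type u₂} [Group N] (B : LCManifold.{u₁, u₂, v} 𝕜 N) (φ : MulAut N) : Prop :=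
  B.Diffeo B φ.toEquiv

/-- The homomorphism `r` is a smooth action of `G` on `N` by Lie group automorphisms. -/
def IsSmoothAction {G : Type u₂} [Group G] {N : Type u₃} [Group N]
    (A : LCManifold.{u₁, u₂, v} 𝕜 G) (B : LCManifold.{u₁, u₃, v} 𝕜 N) (r : G →* MulAut N) : Prop :=
  (∀ g, IsLieAut B (r g)) ∧ (A.prod B).Smooth B (fun p => r p.1 p.2)

/-- A smooth crossed module `α : H → G` with the action `r` of `G` on `H`. -/
structure IsSmoothCrossedModule {H : Type u₂} [Group H] {G : Type u₃} [Group G]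
    (A : LCManifold.{u₁, u₂, v} 𝕜 H) (B : LCManifold.{u₁, u₃, v} 𝕜 G)
    (α : H →* G) (r : G →* MulAut H) : Prop where
  lie_source : A.IsLieGroup
  lie_target : B.IsLieGroup
  smooth : A.Smooth B α
  action : IsSmoothAction B A r
  equivariant : ∀ (g : G) (h : H), α (r g h) = g * α h * g⁻¹
  peiffer : ∀ h : H, r (α h) = MulAut.conj h
  split : ∃ (K : SplitLieSubgroup A α.ker) (I : SplitLieSubgroup B α.range),
    K.quot.Diffeo I.sub (QuotientGroup.quotientKerEquivRange α).toEquiv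

/-! ## Locally smooth cochains -/

/-- `δ_f (g, g') = f(g) f(g') f(g g')⁻¹`. -/
def delta {G : Type u₂} [Group G] {K : Type u₃} [Group K] (f : G → K) (g g' : G) : K :=
  f g * f g' * (f (g * g'))⁻¹

/-- The set `C^1_s(G, N)` of normalized locally smooth `1`-cochains. -/
def IsCochain₁ {G : Type u₂} [Group G] {N : Type u₃} [Group N]
    (A : LCManifold.{u₁, u₂, v} 𝕜 G) (B : LCManifold.{u₁, u₃, v} 𝕜 N) (f : G → N) : Prop :=
  f 1 = 1 ∧ ∃ U : Set G, A.IsOpenSet U ∧ 1 ∈ U ∧ A.SmoothOn B f U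

/-- The set `C^2_s(G, N)` of normalized locally smooth `2`-cochains. -/
def IsCochain₂ {G : Type u₂} [Group G] {N : Type u₃} [Group N]
    (A : LCManifold.{u₁, u₂, v} 𝕜 G) (B : LCManifold.{u₁, u₃, v} 𝕜 N) (ω : G × G → N) : Prop :=
  (∀ g, ω (1, g) = 1) ∧ (∀ g, ω (g, 1) = 1) ∧
    ∃ U : Set (G × G), (A.prod A).IsOpenSet U ∧ 1 ∈ U ∧ (A.prod A).SmoothOn B ω U

/-- The subset `C^2_ss(G, N)` of `C^2_s(G, N)`: for each `g`, the map
`x ↦ ω(g, x) ω(g x g⁻¹, g)⁻¹` is smooth in an identity neighbourhood. -/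
def IsCochain₂ss {G : Type u₂} [Group G] {N : Type u₃} [Group N]
    (A : LCManifold.{u₁, u₂, v} 𝕜 G) (B : LCManifold.{u₁, u₃, v} 𝕜 N) (ω : G × G → N) : Prop :=
  IsCochain₂ A B ω ∧ ∀ g : G, ∃ U : Set G, A.IsOpenSet U ∧ 1 ∈ U ∧
    A.SmoothOn B (fun x => ω (g, x) * (ω (g * x * g⁻¹, g))⁻¹) U

/-! ## Smooth outer actions -/

/-- A smooth outer action of `G` on `N`. -/
structure SmoothOuterAction {G : Type u₂} [Group G] {N : Type u₃} [Group N]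
    (A : LCManifold.{u₁, u₂, v} 𝕜 G) (B : LCManifold.{u₁, u₃, v} 𝕜 N) where
  toFun : G → MulAut N
  lieAut : ∀ g, IsLieAut B (toFun g)
  normalized : toFun 1 = 1
  locally_smooth : ∃ U : Set G, A.IsOpenSet U ∧ 1 ∈ U ∧
    (A.prod B).SmoothOn B (fun p => toFun p.1 p.2) (U ×ˢ univ)
  outer : ∃ ω : G × G → N, IsCochain₂ A B ω ∧
    ∀ g g', delta toFun g g' = MulAut.conj (ω (g, g'))

/-- The homomorphism `N ⧸ Z(N) → Aut(N)` induced by conjugation. -/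
def conjAd {N : Type u₃} [Group N] : N ⧸ Subgroup.center N →* MulAut N :=
  QuotientGroup.lift (Subgroup.center N) MulAut.conj (fun z hz => by
    ext n
    have := Subgroup.mem_center_iff.1 hz n
    simp [← this])

theorem conjAd_injective {N : Type u₃} [Group N] : Function.Injective (conjAd (N := N)) := by
  rw [injective_iff_map_eq_one]
  intro a
  induction a using QuotientGroup.induction_on with
  | H n =>
    intro h
    refine (QuotientGroup.eq_one_iff n).2 (Subgroup.mem_center_iff.2 fun m => ?_)
    have h' : n * m * n⁻¹ = m := DFunLike.congr_fun h m
    exact (mul_inv_eq_iff_eq_mul.1 h').symm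

namespace SmoothOuterAction

variable {G : Type u₂} [Group G] {N : Type u₃} [Group N]
  {A : LCManifold.{u₁, u₂, v} 𝕜 G} {B : LCManifold.{u₁, u₃, v} 𝕜 N}

/-- `S` is strongly smooth: `ω` with `δ_S = C_N ∘ ω` can be chosen in `C^2_ss(G, N)`. -/
def IsStronglySmooth (S : SmoothOuterAction A B) : Prop :=
  ∃ ω : G × G → N, IsCochain₂ss A B ω ∧
    ∀ g g', delta S.toFun g g' = MulAut.conj (ω (g, g'))

/-- `S ∼ S'`, i.e. `S' = (C_N ∘ h) · S` for some `h` in `C^1_s(G, N)`. -/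
def Equivalent (S S' : SmoothOuterAction A B) : Prop :=
  ∃ h : G → N, IsCochain₁ A B h ∧ ∀ g, S'.toFun g = MulAut.conj (h g) * S.toFun g

/-- The automorphism `n Z(N) ↦ S(g)(n) Z(N)` of `N ⧸ Z(N)`. -/
def actAd (S : SmoothOuterAction A B) (g : G) :
    N ⧸ Subgroup.center N →* N ⧸ Subgroup.center N :=
  QuotientGroup.map (Subgroup.center N) (Subgroup.center N) (S.toFun g).toMonoidHom
    (fun z hz => Subgroup.mem_center_iff.2 fun n => by
      have := Subgroup.mem_center_iff.1 hz ((S.toFun g).symm n)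
      simpa using congrArg (S.toFun g) this)

/-- `δ_S` as a function with values in `N ⧸ Z(N)`; see `conjAd_deltaAd`. -/
noncomputable def deltaAd (S : SmoothOuterAction A B) (g g' : G) : N ⧸ Subgroup.center N :=
  ((S.outer.choose (g, g') : N) : N ⧸ Subgroup.center N)

theorem conjAd_deltaAd (S : SmoothOuterAction A B) (g g' : G) :
    conjAd (S.deltaAd g g') = delta S.toFun g g' :=
  (S.outer.choose_spec.2 g g').symm

theorem conjAd_actAd (S : SmoothOuterAction A B) (g : G) (a : N ⧸ Subgroup.center N) :
    conjAd (S.actAd g a) = S.toFun g * conjAd a * (S.toFun g)⁻¹ := by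
  induction a using QuotientGroup.induction_on with
  | H n =>
    ext m
    change S.toFun g n * m * (S.toFun g n)⁻¹ = S.toFun g (n * (S.toFun g)⁻¹ m * n⁻¹)
    simp

theorem deltaAd_one_one (S : SmoothOuterAction A B) : S.deltaAd 1 1 = 1 :=
  conjAd_injective (by rw [conjAd_deltaAd, map_one conjAd]; simp [delta, S.normalized])

/-- The underlying set `N_ad × G` of `G^S`, where `N_ad = N ⧸ Z(N)`. -/
@[ext]
structure GS (S : SmoothOuterAction A B) where
  ad : N ⧸ Subgroup.center N
  base : G

namespace GS

variable {S : SmoothOuterAction A B}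

/-- `(a, g) (a', g') = (a · S(g)(a') · δ_S(g, g'), g g')`. -/
noncomputable instance : Mul S.GS :=
  ⟨fun x y => ⟨x.ad * S.actAd x.base y.ad * S.deltaAd x.base y.base, x.base * y.base⟩⟩

instance : One S.GS := ⟨⟨1, 1⟩⟩

noncomputable instance : Inv S.GS :=
  ⟨fun x => ⟨(S.deltaAd x.base⁻¹ x.base)⁻¹ * (S.actAd x.base⁻¹ x.ad)⁻¹, x.base⁻¹⟩⟩

theorem mul_def (x y : S.GS) :
    x * y = ⟨x.ad * S.actAd x.base y.ad * S.deltaAd x.base y.base, x.base * y.base⟩ := rfl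

theorem one_def : (1 : S.GS) = ⟨1, 1⟩ := rfl

theorem inv_def (x : S.GS) :
    x⁻¹ = ⟨(S.deltaAd x.base⁻¹ x.base)⁻¹ * (S.actAd x.base⁻¹ x.ad)⁻¹, x.base⁻¹⟩ := rfl

theorem conjAd_mul (x y : S.GS) :
    conjAd (x * y).ad * S.toFun (x * y).base =
      (conjAd x.ad * S.toFun x.base) * (conjAd y.ad * S.toFun y.base) := by
  simp only [mul_def, map_mul, conjAd_actAd, conjAd_deltaAd, delta]
  group

theorem ext_conjAd {x y : S.GS} (hb : x.base = y.base)
    (h : conjAd x.ad * S.toFun x.base = conjAd y.ad * S.toFun y.base) : x = y := by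
  refine GS.ext (conjAd_injective ?_) hb
  rw [hb] at h
  exact mul_right_cancel h

noncomputable instance : Group S.GS :=
  Group.ofLeftAxioms
    (fun x y z => ext_conjAd (mul_assoc _ _ _) (by simp only [conjAd_mul, mul_assoc]))
    (fun x => ext_conjAd (one_mul _) (by
      rw [conjAd_mul]; simp [one_def, S.normalized]))
    (fun x => GS.ext
      (by
        simp only [mul_def, inv_def, one_def]
        group)
      (inv_mul_cancel x.base))

/-- The projection `q_S : G^S → G`. -/
noncomputable def proj (S : SmoothOuterAction A B) : S.GS →* G where
  toFun x := x.base
  map_one' := rfl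
  map_mul' _ _ := rfl

/-- The inclusion `N_ad → G^S`, `a ↦ (a, 1)`. -/
noncomputable def incl (S : SmoothOuterAction A B) : N ⧸ Subgroup.center N →* S.GS where
  toFun a := ⟨a, 1⟩
  map_one' := rfl
  map_mul' a b := ext_conjAd (one_mul _).symm (by
    rw [conjAd_mul]; simp [S.normalized])

/-- `L` is a Lie group structure on `G^S` for which the identical map `N_ad × G → G^S` restricts
to a diffeomorphism of `N_ad × U` onto the open subset `q_S ⁻¹ U`, for some open identity
neighbourhood `U` of `G`. Here `Q` is the manifold structure of `N_ad`. -/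
structure IsNatural (S : SmoothOuterAction A B)
    (Q : LCManifold.{u₁, u₃, v} 𝕜 (N ⧸ Subgroup.center N))
    (L : LCManifold.{u₁, max u₂ u₃, v} 𝕜 S.GS) : Prop where
  lie : L.IsLieGroup
  local_product : ∃ U : Set G, A.IsOpenSet U ∧ 1 ∈ U ∧ L.IsOpenSet (proj S ⁻¹' U) ∧
    (Q.prod A).SmoothOn L (fun p => (⟨p.1, p.2⟩ : S.GS)) (univ ×ˢ U) ∧
    L.SmoothOn (Q.prod A) (fun x => (x.ad, x.base)) (proj S ⁻¹' U)

end GS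

end SmoothOuterAction

end LieGroups

/-!
Since `C_N` embeds `N_ad` into `Aut(N)`, the map `x ↦ (ρ(x), q_S(x))` embeds `G^S` into
`Aut(N) × G`, and all algebraic identities in `G^S` can be checked there.

The product manifold `N_ad × G` need not make `G^S` a Lie group, because `S` and `ω` are only smooth
near the identity. But multiplication and inversion are smooth near `1`, and so is conjugation by
every element `(a, g) = (a, 1)(1, g)`: for `(a, 1)` because `S` is smooth near `1`, for `(1, g)`
because `ω` lies in `C²_ss`. By the classical local-to-global principle, the left translates of the
charts on a small identity neighbourhood then define a Lie group structure which agrees with the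
product structure near `1`.

A homomorphism of Lie groups is smooth as soon as it is smooth near `1`, where `G^S` is a product.
This gives uniqueness, the extension, its dependence on `[S]` only, and the crossed module.
-/

universe w₁ w₂ w₃ w₄ w₅

/-! ### Calculus -/

section Calculus

variable {𝕜 : Type u₁} [RCLike 𝕜]
  {E : Type u₂} [AddCommGroup E] [Module 𝕜 E] [TopologicalSpace E]
  {E' : Type u₃} [AddCommGroup E'] [Module 𝕜 E'] [TopologicalSpace E']
  {F : Type u₄} [AddCommGroup F] [Module 𝕜 F] [TopologicalSpace F]

theorem CnOn.of_succ {n : ℕ} {f : E → F} {U : Set E} (h : CnOn 𝕜 (n + 1) f U) :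
    CnOn 𝕜 n f U := by
  induction n generalizing E F with
  | zero => exact h.1
  | succ n ih =>
    obtain ⟨hc, df, hd, hs⟩ := h
    exact ⟨hc, df, hd, ih hs⟩

theorem cnOn_const (n : ℕ) (c : F) (U : Set E) : CnOn 𝕜 n (fun _ : E => c) U := by
  induction n generalizing E F with
  | zero => exact continuousOn_const
  | succ n ih =>
    refine ⟨continuousOn_const, fun _ => 0, fun x _ h => ?_, ih 0 _⟩
    simpa only [sub_self, smul_zero] using tendsto_const_nhds

theorem tendsto_add_smul_nhdsNE [ContinuousAdd E] [ContinuousSMul 𝕜 E] (x h : E) :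
    Tendsto (fun t : 𝕜 => x + t • h) (𝓝[≠] 0) (𝓝 x) := by
  have hcont : Continuous fun t : 𝕜 => x + t • h := by fun_prop
  simpa only [zero_smul, add_zero] using (hcont.tendsto 0).mono_left nhdsWithin_le_nhds

theorem CnOn.congr [ContinuousAdd E] [ContinuousSMul 𝕜 E] {n : ℕ} {f g : E → F}
    {U : Set E} (hf : CnOn 𝕜 n f U) (hU : IsOpen U) (h : EqOn g f U) : CnOn 𝕜 n g U := by
  cases n with
  | zero => exact ContinuousOn.congr hf h
  | succ n =>
    obtain ⟨hc, df, hd, hs⟩ := hf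
    refine ⟨hc.congr h, df, fun x hx k => (hd x hx k).congr' ?_, hs⟩
    filter_upwards [(tendsto_add_smul_nhdsNE (𝕜 := 𝕜) x k).eventually (hU.mem_nhds hx)] with t ht
    rw [h hx, h ht]

variable (𝕜) in
/-- The directional derivative of `f` at the point `p.1` in the direction `p.2`, with an unspecified
value where it does not exist. It does not depend on an open set, so that derivatives chosen on
different open sets can be compared. -/
noncomputable def dirDeriv (f : E → F) (p : E × E) : F :=
  letI : Nonempty F := ⟨0⟩
  limUnder (𝓝[≠] (0 : 𝕜)) fun t => t⁻¹ • (f (p.1 + t • p.2) - f p.1)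

theorem CnOn.dirDeriv_spec [ContinuousAdd E] [ContinuousSMul 𝕜 E] [T2Space F] {n : ℕ}
    {f : E → F} {U : Set E} (hf : CnOn 𝕜 (n + 1) f U) (hU : IsOpen U) :
    (∀ x ∈ U, ∀ h : E, Tendsto (fun t : 𝕜 => t⁻¹ • (f (x + t • h) - f x)) (𝓝[≠] 0)
      (𝓝 (dirDeriv 𝕜 f (x, h)))) ∧ CnOn 𝕜 n (dirDeriv 𝕜 f) (U ×ˢ univ) := by
  obtain ⟨-, df, hd, hs⟩ := hf
  have heq : EqOn (dirDeriv 𝕜 f) df (U ×ˢ univ) := fun p hp => (hd p.1 hp.1 p.2).limUnder_eq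
  refine ⟨fun x hx h => ?_, hs.congr (hU.prod isOpen_univ) heq⟩
  rw [heq ⟨hx, mem_univ _⟩]
  exact hd x hx h

theorem CnOn.of_locally [ContinuousAdd E] [ContinuousSMul 𝕜 E] [T2Space F] {n : ℕ}
    {f : E → F} {U : Set E} (h : ∀ x ∈ U, ∃ W : Set E, IsOpen W ∧ x ∈ W ∧ CnOn 𝕜 n f W) :
    CnOn 𝕜 n f U := by
  have hc : ContinuousOn f U := fun x hx => by
    obtain ⟨W, hW, hxW, hf⟩ := h x hx
    exact (hf.continuousOn.continuousAt (hW.mem_nhds hxW)).continuousWithinAt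
  induction n generalizing E F with
  | zero => exact hc
  | succ n ih =>
    have hdf : ∀ p ∈ U ×ˢ (univ : Set E),
        ∃ W : Set (E × E), IsOpen W ∧ p ∈ W ∧ CnOn 𝕜 n (dirDeriv 𝕜 f) W := fun p hp => by
      obtain ⟨W, hW, hxW, hf⟩ := h p.1 hp.1
      exact ⟨W ×ˢ univ, hW.prod isOpen_univ, ⟨hxW, mem_univ _⟩, (hf.dirDeriv_spec hW).2⟩
    refine ⟨hc, dirDeriv 𝕜 f, fun x hx k => ?_, ih hdf fun p hp => ?_⟩
    · obtain ⟨W, hW, hxW, hf⟩ := h x hx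
      exact (hf.dirDeriv_spec hW).1 x hxW k
    · obtain ⟨W, hW, hpW, hf⟩ := hdf p hp
      exact (hf.continuousOn.continuousAt (hW.mem_nhds hpW)).continuousWithinAt

theorem seminorm_sub_le_of_tendsto_slope [ContinuousSub F] {p : Seminorm 𝕜 F} (hp : Continuous p)
    {φ φ' : ℝ → F} {a b C : ℝ} (hab : a ≤ b) (hφ : ContinuousOn φ (Icc a b))
    (hd : ∀ s ∈ Ico a b,
      Tendsto (fun z : ℝ => ((z - s : ℝ) : 𝕜)⁻¹ • (φ z - φ s)) (𝓝[>] s) (𝓝 (φ' s)))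
    (hC : ∀ s ∈ Ico a b, p (φ' s) ≤ C) : p (φ b - φ a) ≤ C * (b - a) := by
  refine image_le_of_liminf_slope_right_le_deriv_boundary (f := fun s => p (φ s - φ a))
    (B := fun s => C * (s - a)) (B' := fun _ => C)
    (hp.comp_continuousOn (hφ.sub continuousOn_const)) (by simp) (by fun_prop)
    (fun s _ => ?_) (fun s hs r hr => Eventually.frequently ?_) (right_mem_Icc.2 hab)
  · simpa using (((hasDerivAt_id s).sub_const a).const_mul C).hasDerivWithinAt
  filter_upwards [((hp.tendsto _).comp (hd s hs)).eventually_lt_const ((hC s hs).trans_lt hr),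
    self_mem_nhdsWithin] with z hz hsz
  have hpos : 0 < z - s := sub_pos.2 hsz
  calc slope (fun s => p (φ s - φ a)) s z
      = (z - s)⁻¹ * (p (φ z - φ a) - p (φ s - φ a)) := by rw [slope_def_field, div_eq_inv_mul]
    _ ≤ (z - s)⁻¹ * p (φ z - φ s) := by
      gcongr
      rw [sub_le_iff_le_add]
      simpa only [sub_add_sub_cancel] using map_add_le_add p (φ z - φ s) (φ s - φ a)
    _ = p (((z - s : ℝ) : 𝕜)⁻¹ • (φ z - φ s)) := by
      rw [map_smul_eq_mul, norm_inv, RCLike.norm_ofReal, abs_of_pos hpos]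
    _ < r := hz

theorem seminorm_differenceQuotient_sub_le [ContinuousAdd E] [ContinuousSMul 𝕜 E]
    [IsTopologicalAddGroup F] [ContinuousSMul 𝕜 F] {p : Seminorm 𝕜 F} (hp : Continuous p)
    {f : E → F} {df : E × E → F} {U : Set E} (hf : ContinuousOn f U)
    (hd : ∀ x ∈ U, ∀ h : E,
      Tendsto (fun t : 𝕜 => t⁻¹ • (f (x + t • h) - f x)) (𝓝[≠] 0) (𝓝 (df (x, h))))
    {t : 𝕜} (ht : t ≠ 0) {y k : E} (hU : ∀ s ∈ Icc (0 : ℝ) 1, y + ((s : 𝕜) * t) • k ∈ U)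
    {w : F} {C : ℝ} (hC : ∀ s ∈ Icc (0 : ℝ) 1, p (df (y + ((s : 𝕜) * t) • k, k) - w) ≤ C) :
    p (t⁻¹ • (f (y + t • k) - f y) - w) ≤ C := by
  have : Continuous fun s : ℝ => (s : 𝕜) := RCLike.continuous_ofReal
  let γ : ℝ → E := fun s => y + ((s : 𝕜) * t) • k
  let φ : ℝ → F := fun s => t⁻¹ • f (γ s) - (s : 𝕜) • w
  have hφ : ContinuousOn φ (Icc 0 1) :=
    ((hf.comp (by fun_prop) hU).const_smul t⁻¹).sub (by fun_prop)
  have hφ' : ∀ s ∈ Ico (0 : ℝ) 1, Tendsto (fun z : ℝ => ((z - s : ℝ) : 𝕜)⁻¹ • (φ z - φ s))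
      (𝓝[>] s) (𝓝 (df (γ s, k) - w)) := fun s hs => by
    have hstep : Tendsto (fun z : ℝ => ((z - s : ℝ) : 𝕜) * t) (𝓝[>] s) (𝓝[≠] 0) := by
      refine tendsto_nhdsWithin_iff.2 ⟨?_, ?_⟩
      · have : Continuous fun z : ℝ => ((z - s : ℝ) : 𝕜) * t := by fun_prop
        simpa using (this.tendsto s).mono_left nhdsWithin_le_nhds
      · filter_upwards [self_mem_nhdsWithin] with z hz
        exact mul_ne_zero (RCLike.ofReal_ne_zero.2 (sub_pos.2 hz).ne') ht
    refine (((hd _ (hU s (Ico_subset_Icc_self hs)) k).comp hstep).sub_const w).congr' ?_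
    filter_upwards [self_mem_nhdsWithin] with z hz
    have hne : ((z - s : ℝ) : 𝕜) ≠ 0 := RCLike.ofReal_ne_zero.2 (sub_pos.2 hz).ne'
    have hγ : y + ((s : 𝕜) * t) • k + (((z - s : ℝ) : 𝕜) * t) • k = γ z := by
      simp only [γ]; push_cast; module
    have hw : w = ((z - s : ℝ) : 𝕜)⁻¹ • ((z : 𝕜) • w - (s : 𝕜) • w) := by
      rw [← sub_smul, ← RCLike.ofReal_sub, inv_smul_smul₀ hne]
    simp only [Function.comp_apply, hγ, φ]
    rw [mul_inv]
    conv_lhs => rw [hw]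
    module
  have := seminorm_sub_le_of_tendsto_slope hp zero_le_one hφ hφ'
    fun s hs => hC s (Ico_subset_Icc_self hs)
  simpa [φ, γ, smul_sub, sub_right_comm] using this

theorem eventually_forall_segment [ContinuousAdd E] [ContinuousSMul 𝕜 E] {x h : E}
    {Q : E × E → Prop} (hQ : ∀ᶠ y in 𝓝 (x, h), Q y) :
    ∀ᶠ q : 𝕜 × E × E in 𝓝 (0, x, h), ∀ s ∈ Icc (0 : ℝ) 1,
      Q (q.2.1 + ((s : 𝕜) * q.1) • q.2.2, q.2.2) := by
  refine isCompact_Icc.eventually_forall_of_forall_eventually fun s _ => ?_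
  have : Continuous fun z : (𝕜 × E × E) × ℝ => (z.2 : 𝕜) :=
    RCLike.continuous_ofReal.comp continuous_snd
  have hcont : Continuous fun z : (𝕜 × E × E) × ℝ =>
      (z.1.2.1 + ((z.2 : 𝕜) * z.1.1) • z.1.2.2, z.1.2.2) := by fun_prop
  have hlim := hcont.tendsto ((0, x, h), s)
  simp only [mul_zero, zero_smul, add_zero] at hlim
  exact hlim.eventually hQ

theorem tendsto_differenceQuotient [ContinuousAdd E] [ContinuousSMul 𝕜 E]
    [PolynormableSpace 𝕜 F] {f : E → F} {U : Set E} (hU : IsOpen U)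
    (hf : ContinuousOn f U) {df : E × E → F}
    (hd : ∀ x ∈ U, ∀ h : E,
      Tendsto (fun t : 𝕜 => t⁻¹ • (f (x + t • h) - f x)) (𝓝[≠] 0) (𝓝 (df (x, h))))
    (hdf : ContinuousOn df (U ×ˢ univ)) {x : E} (hx : x ∈ U) (h : E) :
    Tendsto (fun q : 𝕜 × E × E => q.1⁻¹ • (f (q.2.1 + q.1 • q.2.2) - f q.2.1))
      (𝓝[≠] 0 ×ˢ 𝓝 (x, h)) (𝓝 (df (x, h))) := by
  have hws := PolynormableSpace.withSeminorms 𝕜 F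
  have := hws.topologicalAddGroup
  have := hws.continuousSMul
  rw [hws.tendsto_nhds]
  rintro ⟨p, hp⟩ ε hε
  have hxU : U ×ˢ (univ : Set E) ∈ 𝓝 (x, h) :=
    (hU.prod isOpen_univ).mem_nhds ⟨hx, mem_univ _⟩
  have hnear : ∀ᶠ y in 𝓝 (x, h), p (df y - df (x, h)) < ε / 2 := by
    have hcont : ContinuousAt (fun y => p (df y - df (x, h))) (x, h) :=
      hp.continuousAt.comp ((hdf.continuousAt hxU).sub continuousAt_const)
    refine hcont.eventually_lt continuousAt_const ?_
    simpa only [sub_self, map_zero] using half_pos hε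
  have hsegment := (eventually_forall_segment (𝕜 := 𝕜) (hnear.and hxU)).filter_mono
    ((Filter.prod_mono_left _ (nhdsWithin_le_nhds (s := {0}ᶜ))).trans_eq nhds_prod_eq.symm)
  filter_upwards [hsegment, tendsto_fst.eventually self_mem_nhdsWithin]
    with ⟨t, y, k⟩ hq ht
  exact (seminorm_differenceQuotient_sub_le hp hf hd ht (fun s hs => (hq s hs).2.1)
    fun s hs => (hq s hs).1.le).trans_lt (half_lt_self hε)

theorem CnOn.comp [ContinuousAdd E'] [ContinuousSMul 𝕜 E'] [PolynormableSpace 𝕜 F] {n : ℕ}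
    {f : E' → F} {g : E → E'} {U : Set E} {V : Set E'}
    (hf : CnOn 𝕜 n f V) (hg : CnOn 𝕜 n g U) (hV : IsOpen V) (h : MapsTo g U V) :
    CnOn 𝕜 n (fun x => f (g x)) U := by
  induction n generalizing E E' F with
  | zero => exact ContinuousOn.comp hf hg h
  | succ n ih =>
    have hg' := hg.of_succ
    obtain ⟨hfc, df, hdf, hfs⟩ := hf
    obtain ⟨hgc, dg, hdg, hgs⟩ := hg
    refine ⟨hfc.comp hgc h, fun p => df (g p.1, dg p), fun x hx k => ?_, ?_⟩
    · have hquot := tendsto_differenceQuotient hV hfc hdf hfs.continuousOn (h hx) (dg (x, k))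
      have hin : Tendsto (fun t : 𝕜 => (t, g x, t⁻¹ • (g (x + t • k) - g x))) (𝓝[≠] 0)
          (𝓝[≠] 0 ×ˢ 𝓝 (g x, dg (x, k))) :=
        tendsto_id.prodMk (tendsto_const_nhds.prodMk_nhds (hdg x hx k))
      refine (hquot.comp hin).congr' ?_
      filter_upwards [self_mem_nhdsWithin] with t ht
      simp only [Function.comp_apply, smul_inv_smul₀ ht, add_sub_cancel]
    · have hpair : CnOn 𝕜 n (fun p : E × E => (g p.1, dg p)) (U ×ˢ univ) :=
        ((hg'.comp_linear (ContinuousLinearMap.fst 𝕜 E E)).mono fun p hp => hp.1).prodMk hgs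
      exact ih (f := df) hfs hpair (hV.prod isOpen_univ) fun p hp => ⟨h hp.1, mem_univ _⟩

end Calculus

/-! ### Smooth maps -/

namespace LCManifold

variable {𝕜 : Type u₁} [RCLike 𝕜]

/-- The neighbourhood filter in the topology of the manifold. -/
def nhds {M : Type u₂} (A : LCManifold.{u₁, u₂, v} 𝕜 M) (x : M) : Filter M :=
  letI := A.top
  𝓝 x

/-- `f` is smooth on an open neighbourhood of `x`. -/
def SmoothAt {M : Type u₂} {M' : Type u₃} (A : LCManifold.{u₁, u₂, v} 𝕜 M)
    (B : LCManifold.{u₁, u₃, v} 𝕜 M') (f : M → M') (x : M) : Prop :=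
  ∃ U : Set M, A.IsOpenSet U ∧ x ∈ U ∧ A.SmoothOn B f U

variable {M₁ : Type w₁} {M₂ : Type w₂} {M₃ : Type w₃}
  {A : LCManifold.{u₁, w₁, v} 𝕜 M₁} {B : LCManifold.{u₁, w₂, v} 𝕜 M₂}
  {C : LCManifold.{u₁, w₃, v} 𝕜 M₃}

theorem IsOpenSet.mem_nhds {U : Set M₁} (hU : A.IsOpenSet U) {x : M₁} (hx : x ∈ U) :
    U ∈ A.nhds x :=
  letI := A.top
  IsOpen.mem_nhds hU hx

theorem mem_nhds_iff {s : Set M₁} {x : M₁} :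
    s ∈ A.nhds x ↔ ∃ U ⊆ s, A.IsOpenSet U ∧ x ∈ U :=
  letI := A.top
  _root_.mem_nhds_iff

theorem isOpenSet_iff {U : Set M₁} : A.IsOpenSet U ↔ ∀ x ∈ U, U ∈ A.nhds x :=
  letI := A.top
  isOpen_iff_mem_nhds

theorem isOpenSet_univ : A.IsOpenSet univ :=
  letI := A.top
  isOpen_univ

theorem IsOpenSet.inter {U V : Set M₁} (hU : A.IsOpenSet U) (hV : A.IsOpenSet V) :
    A.IsOpenSet (U ∩ V) :=
  letI := A.top
  IsOpen.inter hU hV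

theorem IsOpenSet.prod {U : Set M₁} {V : Set M₂} (hU : A.IsOpenSet U) (hV : B.IsOpenSet V) :
    (A.prod B).IsOpenSet (U ×ˢ V) :=
  letI := A.top
  letI := B.top
  IsOpen.prod hU hV

theorem nhds_prod (x : M₁ × M₂) : (A.prod B).nhds x = A.nhds x.1 ×ˢ B.nhds x.2 :=
  letI := A.top
  letI := B.top
  nhds_prod_eq

theorem mem_of_mem_nhds {s : Set M₁} {x : M₁} (h : s ∈ A.nhds x) : x ∈ s :=
  letI := A.top
  _root_.mem_of_mem_nhds h

theorem eventually_self {p : M₁ → Prop} {x : M₁} (h : ∀ᶠ y in A.nhds x, p y) : p x :=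
  mem_of_mem_nhds h

theorem isOpenSet_setOf_eventually (A : LCManifold.{u₁, w₁, v} 𝕜 M₁) (p : M₁ → Prop) :
    A.IsOpenSet {x | ∀ᶠ y in A.nhds x, p y} :=
  letI := A.top
  isOpen_setOfPred_eventually_nhds

theorem SmoothOn.mono {f : M₁ → M₂} {U V : Set M₁} (h : A.SmoothOn B f U) (hVU : V ⊆ U) :
    A.SmoothOn B f V := by
  let := A.top
  let := B.top
  let := A.charted
  let := B.charted
  exact ⟨h.1.mono hVU, fun e he e' he' n =>
    (h.2 e he e' he' n).mono fun x hx => ⟨hx.1, hVU hx.2.1, hx.2.2⟩⟩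

theorem SmoothOn.smoothAt {f : M₁ → M₂} {U : Set M₁} (h : A.SmoothOn B f U)
    (hU : A.IsOpenSet U) {x : M₁} (hx : x ∈ U) : A.SmoothAt B f x :=
  ⟨U, hU, hx, h⟩

theorem Smooth.smoothAt {f : M₁ → M₂} (h : A.Smooth B f) (x : M₁) : A.SmoothAt B f x :=
  SmoothOn.smoothAt h isOpenSet_univ (mem_univ x)

theorem SmoothAt.eventually {f : M₁ → M₂} {x : M₁} (h : A.SmoothAt B f x) :
    ∀ᶠ y in A.nhds x, A.SmoothAt B f y := by
  obtain ⟨U, hU, hx, hf⟩ := h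
  filter_upwards [hU.mem_nhds hx] with y hy
  exact ⟨U, hU, hy, hf⟩

theorem SmoothAt.tendsto {f : M₁ → M₂} {x : M₁} (h : A.SmoothAt B f x) :
    Tendsto f (A.nhds x) (B.nhds (f x)) := by
  let := A.top
  let := B.top
  obtain ⟨U, hU, hx, hf⟩ := h
  exact hf.1.continuousAt (IsOpen.mem_nhds hU hx)

theorem SmoothOn.isOpenSet_inter_preimage {f : M₁ → M₂} {U : Set M₁} (h : A.SmoothOn B f U)
    (hU : A.IsOpenSet U) {V : Set M₂} (hV : B.IsOpenSet V) : A.IsOpenSet (U ∩ f ⁻¹' V) :=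
  letI := A.top
  letI := B.top
  h.1.isOpen_inter_preimage hU hV

theorem smoothOn_of_smoothAt {f : M₁ → M₂} {U : Set M₁} (h : ∀ x ∈ U, A.SmoothAt B f x) :
    A.SmoothOn B f U := by
  let := A.top
  let := B.top
  let := A.charted
  let := B.charted
  refine ⟨fun x hx => ContinuousAt.continuousWithinAt (h x hx).tendsto, fun e he e' he' n => ?_⟩
  refine CnOn.of_locally fun y hy => ?_
  obtain ⟨V, hV, hyV, hf⟩ := h _ hy.2.1
  have hV' : IsOpen V := hV
  refine ⟨_, ?_, ?_, hf.2 e he e' he' n⟩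
  · exact e.isOpen_inter_preimage_symm (hf.1.isOpen_inter_preimage hV' e'.open_source)
  · exact ⟨hy.1, hyV, hy.2.2⟩

theorem smooth_of_smoothAt {f : M₁ → M₂} (h : ∀ x, A.SmoothAt B f x) : A.Smooth B f :=
  smoothOn_of_smoothAt fun x _ => h x

theorem SmoothOn.congr {f g : M₁ → M₂} {U : Set M₁} (h : A.SmoothOn B f U)
    (hU : A.IsOpenSet U) (hfg : EqOn g f U) : A.SmoothOn B g U := by
  let := A.top
  let := B.top
  let := A.charted
  let := B.charted
  have hU' : IsOpen U := hU
  refine ⟨h.1.congr hfg, fun e he e' he' n => ?_⟩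
  have hset : e.target ∩ e.symm ⁻¹' (U ∩ g ⁻¹' e'.source) =
      e.target ∩ e.symm ⁻¹' (U ∩ f ⁻¹' e'.source) := by
    ext x
    simp only [mem_inter_iff, mem_preimage]
    refine and_congr_right fun _ => and_congr_right fun hx => ?_
    rw [hfg hx]
  rw [hset]
  refine CnOn.congr (h.2 e he e' he' n) ?_ fun x hx => ?_
  · exact e.isOpen_inter_preimage_symm (h.1.isOpen_inter_preimage hU' e'.open_source)
  · simp only [hfg hx.2.1]

theorem SmoothAt.congr {f g : M₁ → M₂} {x : M₁} (h : A.SmoothAt B f x)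
    (hfg : ∀ᶠ y in A.nhds x, g y = f y) : A.SmoothAt B g x := by
  obtain ⟨U, hU, hx, hf⟩ := h
  obtain ⟨V, hV, hVo, hxV⟩ := mem_nhds_iff.1 hfg
  exact ⟨U ∩ V, hU.inter hVo, ⟨hx, hxV⟩,
    (hf.mono inter_subset_left).congr (hU.inter hVo) fun y hy => hV hy.2⟩

theorem SmoothOn.comp {g : M₂ → M₃} {f : M₁ → M₂} {U : Set M₁} {V : Set M₂}
    (hg : B.SmoothOn C g V) (hf : A.SmoothOn B f U) (hU : A.IsOpenSet U) (hV : B.IsOpenSet V)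
    (h : MapsTo f U V) : A.SmoothOn C (fun x => g (f x)) U := by
  let := A.top
  let := B.top
  let := C.top
  let := A.charted
  let := B.charted
  let := C.charted
  have hU' : IsOpen U := hU
  have hV' : IsOpen V := hV
  refine ⟨ContinuousOn.comp hg.1 hf.1 h, fun e he e'' he'' n => ?_⟩
  refine CnOn.of_locally fun y hy => ?_
  set e' := chartAt B.Model (f (e.symm y))
  have he' : e' ∈ atlas B.Model M₂ := chart_mem_atlas _ _
  have h₁ := hf.2 e he e' he' n
  have h₂ := hg.2 e' he' e'' he'' n
  have hW : IsOpen (e.target ∩ e.symm ⁻¹' (U ∩ f ⁻¹' e'.source)) :=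
    e.isOpen_inter_preimage_symm (hf.1.isOpen_inter_preimage hU' e'.open_source)
  have hW' : IsOpen (e'.target ∩ e'.symm ⁻¹' (V ∩ g ⁻¹' e''.source)) :=
    e'.isOpen_inter_preimage_symm (hg.1.isOpen_inter_preimage hV' e''.open_source)
  have hO := h₁.continuousOn.isOpen_inter_preimage hW hW'
  have hcomp := h₂.comp (h₁.mono inter_subset_left) hW' (fun x hx => hx.2) (U := _ ∩ _)
  refine ⟨_, hO, ?_, hcomp.congr hO fun x hx => ?_⟩
  · have hys : f (e.symm y) ∈ e'.source := mem_chart_source _ _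
    refine ⟨⟨hy.1, hy.2.1, hys⟩, e'.map_source hys, ?_⟩
    simp only [mem_preimage, e'.left_inv hys]
    exact ⟨h hy.2.1, hy.2.2⟩
  · simp only [e'.left_inv hx.1.2.2]

theorem SmoothAt.comp {g : M₂ → M₃} {f : M₁ → M₂} {x : M₁}
    (hg : B.SmoothAt C g (f x)) (hf : A.SmoothAt B f x) :
    A.SmoothAt C (fun x => g (f x)) x := by
  obtain ⟨V, hV, hxV, hg⟩ := hg
  obtain ⟨U, hU, hxU, hf'⟩ := hf
  have hopen : A.IsOpenSet (U ∩ f ⁻¹' V) := hf'.isOpenSet_inter_preimage hU hV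
  exact ⟨_, hopen, ⟨hxU, hxV⟩, hg.comp (hf'.mono inter_subset_left) hopen hV fun y hy => hy.2⟩

theorem SmoothAt.comp_of_eq {g : M₂ → M₃} {f : M₁ → M₂} {x : M₁} {y : M₂}
    (hg : B.SmoothAt C g y) (hf : A.SmoothAt B f x) (hy : f x = y) :
    A.SmoothAt C (fun x => g (f x)) x := by
  subst hy
  exact hg.comp hf

theorem smooth_id : A.Smooth A (fun x => x) := by
  let := A.top
  let := A.charted
  refine ⟨continuousOn_id, fun e he e' he' n => (A.smooth_change e he e' he' n).mono ?_⟩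
  rintro x ⟨hx, -, hx'⟩
  exact ⟨hx, hx'⟩

theorem smoothAt_id {x : M₁} : A.SmoothAt A (fun x => x) x :=
  smooth_id.smoothAt x

theorem smoothAt_const {c : M₂} {x : M₁} : A.SmoothAt B (fun _ => c) x := by
  let := A.top
  let := B.top
  exact ⟨univ, isOpenSet_univ, mem_univ _, continuousOn_const,
    fun e _ e' _ n => cnOn_const n (e' c) _⟩

theorem smoothAt_fst {x : M₁ × M₂} : (A.prod B).SmoothAt A (fun x => x.1) x := by
  let := A.top
  let := B.top
  let := A.charted
  let := B.charted
  refine ⟨univ, isOpenSet_univ, mem_univ _, continuous_fst.continuousOn, ?_⟩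
  rintro _ ⟨a, ha, b, -, rfl⟩ a' ha' n
  refine ((A.smooth_change a ha a' ha' n).comp_linear
    (ContinuousLinearMap.fst 𝕜 A.Model B.Model)).mono ?_
  rintro ⟨x, y⟩ ⟨hx, -, hx'⟩
  exact ⟨hx.1, hx'⟩

theorem smoothAt_snd {x : M₁ × M₂} : (A.prod B).SmoothAt B (fun x => x.2) x := by
  let := A.top
  let := B.top
  let := A.charted
  let := B.charted
  refine ⟨univ, isOpenSet_univ, mem_univ _, continuous_snd.continuousOn, ?_⟩
  rintro _ ⟨a, -, b, hb, rfl⟩ b' hb' n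
  refine ((B.smooth_change b hb b' hb' n).comp_linear
    (ContinuousLinearMap.snd 𝕜 A.Model B.Model)).mono ?_
  rintro ⟨x, y⟩ ⟨hx, -, hx'⟩
  exact ⟨hx.2, hx'⟩

theorem SmoothOn.prodMk {f : M₁ → M₂} {g : M₁ → M₃} {U : Set M₁}
    (hf : A.SmoothOn B f U) (hg : A.SmoothOn C g U) :
    A.SmoothOn (B.prod C) (fun x => (f x, g x)) U := by
  let := A.top
  let := B.top
  let := C.top
  let := A.charted
  let := B.charted
  let := C.charted
  refine ⟨hf.1.prodMk hg.1, ?_⟩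
  rintro e he _ ⟨b, hb, c, hc, rfl⟩ n
  refine ((hf.2 e he b hb n).mono ?_).prodMk ((hg.2 e he c hc n).mono ?_)
  · rintro x ⟨hx, hxU, hx'⟩
    exact ⟨hx, hxU, hx'.1⟩
  · rintro x ⟨hx, hxU, hx'⟩
    exact ⟨hx, hxU, hx'.2⟩

theorem SmoothAt.prodMk {f : M₁ → M₂} {g : M₁ → M₃} {x : M₁}
    (hf : A.SmoothAt B f x) (hg : A.SmoothAt C g x) :
    A.SmoothAt (B.prod C) (fun x => (f x, g x)) x := by
  obtain ⟨U, hU, hx, hf⟩ := hf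
  obtain ⟨V, hV, hxV, hg⟩ := hg
  exact ⟨U ∩ V, hU.inter hV, ⟨hx, hxV⟩,
    (hf.mono inter_subset_left).prodMk (hg.mono inter_subset_right)⟩

theorem SmoothAt.fst {f : M₁ → M₂ × M₃} {x : M₁} (hf : A.SmoothAt (B.prod C) f x) :
    A.SmoothAt B (fun x => (f x).1) x :=
  smoothAt_fst.comp hf

theorem SmoothAt.snd {f : M₁ → M₂ × M₃} {x : M₁} (hf : A.SmoothAt (B.prod C) f x) :
    A.SmoothAt C (fun x => (f x).2) x :=
  smoothAt_snd.comp hf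

theorem Smooth.isOpenSet_preimage {f : M₁ → M₂} (hf : A.Smooth B f) {U : Set M₂}
    (hU : B.IsOpenSet U) : A.IsOpenSet (f ⁻¹' U) :=
  isOpenSet_iff.2 fun x hx => (hf.smoothAt x).tendsto (hU.mem_nhds hx)

theorem Diffeo.symm {e : M₁ ≃ M₂} (h : A.Diffeo B e) : B.Diffeo A e.symm :=
  ⟨h.2, h.1⟩

theorem Diffeo.trans {e : M₁ ≃ M₂} {e' : M₂ ≃ M₃} (h : A.Diffeo B e) (h' : B.Diffeo C e') :
    A.Diffeo C (e.trans e') :=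
  ⟨smooth_of_smoothAt fun x => (h'.1.smoothAt _).comp (h.1.smoothAt x),
    smooth_of_smoothAt fun x => (h.2.smoothAt _).comp (h'.2.smoothAt x)⟩

end LCManifold

/-! ### Gluing -/

namespace LCManifold

variable {𝕜 : Type u₁} [RCLike 𝕜] {M : Type w₁} {X : Type w₂}

/-- Gluing data for a manifold structure on the set `X`: partial bijections between `X` and a
manifold `M` that cover `X` and have smooth transition maps between open sets, and which separate
the points of `X`, so that the glued space is Hausdorff. -/
structure Gluing (A : LCManifold.{u₁, w₁, v} 𝕜 M) (X : Type w₂) (ι : Type w₃) where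
  chart : ι → PartialEquiv X M
  exists_mem_source : ∀ x, ∃ i, x ∈ (chart i).source
  isOpenSet_overlap : ∀ i j, A.IsOpenSet ((chart i).symm.trans (chart j)).source
  smoothOn_transition : ∀ i j, A.SmoothOn A ((chart i).symm.trans (chart j))
    ((chart i).symm.trans (chart j)).source
  separated : ∀ x y, x ≠ y → ∃ i j, x ∈ (chart i).source ∧ y ∈ (chart j).source ∧
    Disjoint (map (chart i).symm (A.nhds (chart i x))) (map (chart j).symm (A.nhds (chart j y)))

namespace Gluing

variable {ι : Type w₃} {A : LCManifold.{u₁, w₁, v} 𝕜 M} (Γ : A.Gluing X ι)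

/-- The gluing data as an atlas for `X` with values in the topological space `M`. -/
noncomputable def core : letI := A.top; ChartedSpaceCore M X :=
  letI := A.top
  { atlas := range Γ.chart
    chartAt := fun x => Γ.chart (Γ.exists_mem_source x).choose
    mem_chart_source := fun x => (Γ.exists_mem_source x).choose_spec
    chart_mem_atlas := fun _ => mem_range_self _
    open_source := by
      rintro _ _ ⟨i, rfl⟩ ⟨j, rfl⟩
      exact Γ.isOpenSet_overlap i j
    continuousOn_toFun := by
      rintro _ _ ⟨i, rfl⟩ ⟨j, rfl⟩
      exact (Γ.smoothOn_transition i j).1 }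

/-- The glued topology, for which the charts are homeomorphisms between open sets. -/
@[reducible]
noncomputable def topology : TopologicalSpace X :=
  letI := A.top
  Γ.core.toTopologicalSpace

/-- The chart with index `i` as a homeomorphism between open sets. -/
noncomputable def chartHomeo (i : ι) :
    letI := A.top; letI := Γ.topology; OpenPartialHomeomorph X M :=
  letI := A.top
  letI := Γ.topology
  Γ.core.openPartialHomeomorph (Γ.chart i) (mem_range_self i)

theorem t2Space : letI := Γ.topology; T2Space X := by
  let := A.top
  let := Γ.topology
  refine t2Space_iff_disjoint_nhds.2 fun x y hxy => ?_
  obtain ⟨i, j, hx, hy, hdisj⟩ := Γ.separated x y hxy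
  rwa [← (Γ.chartHomeo i).symm_map_nhds_eq hx, ← (Γ.chartHomeo j).symm_map_nhds_eq hy]

theorem exists_eq_chartHomeo {e : letI := A.top; letI := Γ.topology; OpenPartialHomeomorph X M}
    (he : letI := A.top; letI := Γ.topology; e ∈ Γ.core.toChartedSpace.atlas) :
    ∃ i, e = Γ.chartHomeo i := by
  obtain ⟨_, ⟨i, rfl⟩, he⟩ := mem_iUnion₂.1 he
  exact ⟨i, he⟩

/-- The manifold structure on `X` determined by gluing data. Its atlas consists of the compositions
of the gluing charts with the charts of `M`. -/
noncomputable def glue : LCManifold.{u₁, w₂, v} 𝕜 X :=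
  letI := A.top
  letI := A.charted
  letI := Γ.topology
  letI := Γ.core.toChartedSpace
  { Model := A.Model
    top := Γ.topology
    t2 := Γ.t2Space
    charted := ChartedSpace.comp A.Model M X
    smooth_change := by
      rintro _ ⟨e, he, d, hd, rfl⟩ _ ⟨e', he', d', hd', rfl⟩ n
      obtain ⟨i, rfl⟩ := Γ.exists_eq_chartHomeo he
      obtain ⟨j, rfl⟩ := Γ.exists_eq_chartHomeo he'
      refine ((Γ.smoothOn_transition i j).2 d hd d' hd' n).mono ?_
      rintro x ⟨⟨hxd, hxi⟩, hxj, hxd'⟩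
      exact ⟨hxd, ⟨hxi, hxj⟩, hxd'⟩ }

theorem isOpenSet_source (i : ι) : Γ.glue.IsOpenSet (Γ.chart i).source :=
  letI := A.top
  letI := Γ.topology
  (Γ.chartHomeo i).open_source

theorem isOpenSet_target (i : ι) : A.IsOpenSet (Γ.chart i).target :=
  letI := A.top
  letI := Γ.topology
  (Γ.chartHomeo i).open_target

theorem smoothOn_chart (i : ι) : Γ.glue.SmoothOn A (Γ.chart i) (Γ.chart i).source := by
  let := A.top
  let := A.charted
  let := Γ.topology
  refine ⟨(Γ.chartHomeo i).continuousOn, ?_⟩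
  rintro _ ⟨e, he, d, hd, rfl⟩ d' hd' n
  obtain ⟨j, rfl⟩ := Γ.exists_eq_chartHomeo he
  refine ((Γ.smoothOn_transition j i).2 d hd d' hd' n).mono ?_
  rintro x ⟨⟨hxd, hxj⟩, hxi, hxd'⟩
  exact ⟨hxd, ⟨hxj, hxi⟩, hxd'⟩

theorem smoothOn_chart_symm (i : ι) : A.SmoothOn Γ.glue (Γ.chart i).symm (Γ.chart i).target := by
  let := A.top
  let := A.charted
  let := Γ.topology
  refine ⟨(Γ.chartHomeo i).continuousOn_symm, ?_⟩
  rintro d hd _ ⟨e, he, d', hd', rfl⟩ n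
  obtain ⟨j, rfl⟩ := Γ.exists_eq_chartHomeo he
  refine ((Γ.smoothOn_transition i j).2 d hd d' hd' n).mono ?_
  rintro x ⟨hxd, hxi, hxj, hxd'⟩
  exact ⟨hxd, ⟨hxi, hxj⟩, hxd'⟩

theorem smoothAt_chart {i : ι} {x : X} (hx : x ∈ (Γ.chart i).source) :
    Γ.glue.SmoothAt A (Γ.chart i) x :=
  (Γ.smoothOn_chart i).smoothAt (Γ.isOpenSet_source i) hx

theorem smoothAt_chart_symm {i : ι} {y : M} (hy : y ∈ (Γ.chart i).target) :
    A.SmoothAt Γ.glue (Γ.chart i).symm y :=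
  (Γ.smoothOn_chart_symm i).smoothAt (Γ.isOpenSet_target i) hy

end Gluing

theorem disjoint_nhds (A : LCManifold.{u₁, w₁, v} 𝕜 M) {x y : M} (h : x ≠ y) :
    Disjoint (A.nhds x) (A.nhds y) :=
  letI := A.top
  letI := A.t2
  disjoint_nhds_nhds.2 h

/-- Gluing data with a single, global chart. -/
def gluingOfEquiv (A : LCManifold.{u₁, w₁, v} 𝕜 M) (e : X ≃ M) : A.Gluing X Unit where
  chart _ := e.toPartialEquiv
  exists_mem_source _ := ⟨(), mem_univ _⟩
  isOpenSet_overlap _ _ := by simpa using isOpenSet_univ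
  smoothOn_transition _ _ := smoothOn_of_smoothAt fun x _ =>
    smoothAt_id.congr (Eventually.of_forall e.apply_symm_apply)
  separated x y hxy := ⟨(), (), mem_univ _, mem_univ _,
    (disjoint_map e.symm.injective).2 (A.disjoint_nhds (e.injective.ne hxy))⟩

/-- The manifold structure transported along the bijection `e`. -/
noncomputable def comap (A : LCManifold.{u₁, w₁, v} 𝕜 M) (e : X ≃ M) :
    LCManifold.{u₁, w₂, v} 𝕜 X :=
  (A.gluingOfEquiv e).glue

theorem diffeo_comap (A : LCManifold.{u₁, w₁, v} 𝕜 M) (e : X ≃ M) : (A.comap e).Diffeo A e :=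
  ⟨smooth_of_smoothAt fun _ => (A.gluingOfEquiv e).smoothAt_chart (i := ()) (mem_univ _),
    smooth_of_smoothAt fun _ => (A.gluingOfEquiv e).smoothAt_chart_symm (i := ()) (mem_univ _)⟩

end LCManifold

/-! ### Lie groups -/

namespace LCManifold

variable {𝕜 : Type u₁} [RCLike 𝕜]

section LieGroup

variable {M : Type w₁} {G : Type w₂} [Group G] {H : Type w₃} [Group H]
  {D : LCManifold.{u₁, w₁, v} 𝕜 M}
  {A : LCManifold.{u₁, w₂, v} 𝕜 G} {B : LCManifold.{u₁, w₃, v} 𝕜 H}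

theorem IsLieGroup.mul (hA : A.IsLieGroup) {f g : M → G} {x : M}
    (hf : D.SmoothAt A f x) (hg : D.SmoothAt A g x) : D.SmoothAt A (fun x => f x * g x) x :=
  (hA.smooth_mul.smoothAt (f x, g x)).comp_of_eq (hf.prodMk hg) rfl

theorem IsLieGroup.inv (hA : A.IsLieGroup) {f : M → G} {x : M}
    (hf : D.SmoothAt A f x) : D.SmoothAt A (fun x => (f x)⁻¹) x :=
  (hA.smooth_inv.smoothAt (f x)).comp hf

theorem IsLieGroup.smooth_hom (hA : A.IsLieGroup) (hB : B.IsLieGroup) (f : G →* H)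
    (hf : A.SmoothAt B f 1) : A.Smooth B f := by
  refine smooth_of_smoothAt fun x => ?_
  have htranslate : A.SmoothAt B (fun y => f x * f (x⁻¹ * y)) x :=
    hB.mul smoothAt_const
      (hf.comp_of_eq (hA.mul smoothAt_const smoothAt_id) (inv_mul_cancel x))
  refine htranslate.congr (Eventually.of_forall fun y => ?_)
  rw [← map_mul, mul_inv_cancel_left]

theorem IsLieGroup.of_diffeo (hA : A.IsLieGroup) (f : H ≃* G) (hf : B.Diffeo A f.toEquiv) :
    B.IsLieGroup := by
  have hto (y : H) : B.SmoothAt A f y := hf.1.smoothAt y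
  constructor
  · refine smooth_of_smoothAt fun p =>
      ((hf.2.smoothAt _).comp (hA.mul ((hto p.1).comp smoothAt_fst)
        ((hto p.2).comp smoothAt_snd))).congr (Eventually.of_forall fun q => ?_)
    exact f.injective ((map_mul f q.1 q.2).trans (f.apply_symm_apply _).symm)
  · refine smooth_of_smoothAt fun x =>
      ((hf.2.smoothAt _).comp (hA.inv (hto x))).congr (Eventually.of_forall fun y => ?_)
    exact f.injective ((map_inv f y).trans (f.apply_symm_apply _).symm)

theorem IsLieGroup.smoothAt_of_hom_comp (hA : A.IsLieGroup) (hB : B.IsLieGroup) {i : G →* H}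
    {r : H → G} (hr : B.SmoothAt A r 1) (hri : Function.LeftInverse r i) {f : M → G} {x : M}
    (hf : D.SmoothAt B (fun y => i (f y)) x) : D.SmoothAt A f x := by
  have hquot : D.SmoothAt B (fun y => (i (f x))⁻¹ * i (f y)) x := hB.mul smoothAt_const hf
  refine (hA.mul (smoothAt_const (c := f x)) (hr.comp_of_eq hquot (inv_mul_cancel _))).congr
    (Eventually.of_forall fun y => ?_)
  rw [← map_inv, ← map_mul, hri, mul_inv_cancel_left]

end LieGroup

variable {G : Type w₁} [Group G] {A : LCManifold.{u₁, w₁, v} 𝕜 G}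

/-- The manifold structure on the group `G` is that of a Lie group near the identity:
multiplication and inversion are smooth there, and so are all conjugations. -/
structure IsLocallyLieGroup (A : LCManifold.{u₁, w₁, v} 𝕜 G) : Prop where
  smoothAt_mul : (A.prod A).SmoothAt A (fun p => p.1 * p.2) (1, 1)
  smoothAt_inv : A.SmoothAt A (fun x => x⁻¹) 1
  smoothAt_conj : ∀ k : G, A.SmoothAt A (fun x => k * x * k⁻¹) 1

/-- The open set of those elements near which multiplication is smooth enough for left translations
between elements of this set to be smooth, see `IsLocallyLieGroup.smoothAt_mul_left`. -/
def translationDomain (A : LCManifold.{u₁, w₁, v} 𝕜 G) : Set G :=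
  {z | ∀ᶠ y in A.nhds z, (A.prod A).SmoothAt A (fun p => p.1 * p.2) (y⁻¹, y) ∧
    (A.prod A).SmoothAt A (fun p => p.1 * p.2) (y, 1)}

theorem isOpenSet_translationDomain : A.IsOpenSet A.translationDomain :=
  A.isOpenSet_setOf_eventually _

theorem smoothAt_mul_left {w z : G} (hz : z ∈ A.translationDomain)
    (hwz : w * z ∈ A.translationDomain) : A.SmoothAt A (fun x => w * x) z := by
  have hto_one : A.SmoothAt A (fun x => z⁻¹ * x) z :=
    (eventually_self hz).1.comp_of_eq (smoothAt_const.prodMk smoothAt_id) rfl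
  have hfrom_one : A.SmoothAt A (fun y => (w * z) * y) 1 :=
    (eventually_self hwz).2.comp_of_eq (smoothAt_const.prodMk smoothAt_id) rfl
  refine (hfrom_one.comp_of_eq hto_one (inv_mul_cancel z)).congr (Eventually.of_forall fun x => ?_)
  rw [mul_assoc, mul_inv_cancel_left]

namespace IsLocallyLieGroup

theorem one_mem_translationDomain (h : A.IsLocallyLieGroup) : 1 ∈ A.translationDomain := by
  have hleft : Tendsto (fun z : G => (z⁻¹, z)) (A.nhds 1) ((A.prod A).nhds (1, 1)) := by
    simpa only [inv_one] using (h.smoothAt_inv.prodMk smoothAt_id).tendsto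
  have hright : Tendsto (fun z : G => (z, (1 : G))) (A.nhds 1) ((A.prod A).nhds (1, 1)) :=
    (smoothAt_id.prodMk smoothAt_const : A.SmoothAt (A.prod A) _ 1).tendsto
  exact (hleft.eventually h.smoothAt_mul.eventually).and
    (hright.eventually h.smoothAt_mul.eventually)

theorem disjoint_map_mul_left (h : A.IsLocallyLieGroup) {m m' : G} (hne : m ≠ m') :
    Disjoint (map (m * ·) (A.nhds 1)) (map (m' * ·) (A.nhds 1)) := by
  have hdiv : Tendsto (fun p : G × G => p.1 * p.2⁻¹) (A.nhds 1 ×ˢ A.nhds 1) (A.nhds 1) := by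
    have := (h.smoothAt_mul.comp_of_eq (x := ((1 : G), (1 : G)))
      (smoothAt_fst.prodMk (h.smoothAt_inv.comp_of_eq smoothAt_snd rfl)) (by simp)).tendsto
    simpa only [nhds_prod, inv_one, mul_one] using this
  have hcompl : {m⁻¹ * m'}ᶜ ∈ A.nhds 1 :=
    letI := A.top
    letI := A.t2
    isOpen_compl_singleton.mem_nhds (mt inv_mul_eq_one.1 hne ∘ Eq.symm)
  obtain ⟨O, hO, hOO⟩ := mem_prod_same_iff.1 (hdiv hcompl)
  refine Filter.disjoint_iff.2
    ⟨_, image_mem_map hO, _, image_mem_map hO, Set.disjoint_left.2 ?_⟩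
  rintro _ ⟨x, hx, rfl⟩ ⟨x', hx', hxx'⟩
  refine hOO (mk_mem_prod hx hx') ?_
  rw [mem_singleton_iff, eq_inv_mul_iff_mul_eq, ← mul_assoc]
  exact mul_inv_eq_of_eq_mul hxx'.symm

/-- The left translate by `k⁻¹`, from `k` times the translation domain to the translation domain. -/
def translationChart (A : LCManifold.{u₁, w₁, v} 𝕜 G) (k : G) : PartialEquiv G G :=
  (Equiv.mulLeft k⁻¹).toPartialEquiv.trans (PartialEquiv.ofSet A.translationDomain)

theorem mem_overlap_translationChart {k k' x : G} :
    x ∈ ((translationChart A k).symm.trans (translationChart A k')).source ↔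
      x ∈ A.translationDomain ∧ k'⁻¹ * k * x ∈ A.translationDomain := by
  simp [translationChart, mul_assoc]

theorem smoothAt_transition_translationChart {k k' x : G}
    (hx : x ∈ ((translationChart A k).symm.trans (translationChart A k')).source) :
    A.SmoothAt A ((translationChart A k).symm.trans (translationChart A k')) x := by
  obtain ⟨hx, hx'⟩ := mem_overlap_translationChart.1 hx
  refine (smoothAt_mul_left hx hx').congr (Eventually.of_forall fun y => ?_)
  simp [translationChart, mul_assoc]

/-- The left translates of the translation domain as gluing data for the group itself. -/
def translationGluing (h : A.IsLocallyLieGroup) : A.Gluing G G where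
  chart := translationChart A
  exists_mem_source m := ⟨m, by simpa [translationChart] using h.one_mem_translationDomain⟩
  isOpenSet_overlap k k' := isOpenSet_iff.2 fun x hx => by
    obtain ⟨hx, hx'⟩ := mem_overlap_translationChart.1 hx
    filter_upwards [isOpenSet_translationDomain.mem_nhds hx, (smoothAt_mul_left hx hx').tendsto
      (isOpenSet_translationDomain.mem_nhds hx')] with y hy hy'
    exact mem_overlap_translationChart.2 ⟨hy, hy'⟩
  smoothOn_transition _ _ := smoothOn_of_smoothAt fun _ => smoothAt_transition_translationChart
  separated m m' hne := ⟨m, m', by simpa [translationChart] using h.one_mem_translationDomain,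
    by simpa [translationChart] using h.one_mem_translationDomain,
    by simpa [translationChart] using h.disjoint_map_mul_left hne⟩

/-- The manifold structure on a locally Lie group obtained by translating a small identity
neighbourhood. -/
noncomputable def manifold (h : A.IsLocallyLieGroup) : LCManifold.{u₁, w₁, v} 𝕜 G :=
  h.translationGluing.glue

theorem smoothAt_inv_mul (h : A.IsLocallyLieGroup) (m : G) :
    h.manifold.SmoothAt A (fun x => m⁻¹ * x) m :=
  h.translationGluing.smoothAt_chart (i := m)
    (by simpa [translationGluing, translationChart] using h.one_mem_translationDomain)

theorem smoothAt_mul_left_one (h : A.IsLocallyLieGroup) (m : G) :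
    A.SmoothAt h.manifold (fun x => m * x) 1 := by
  have := h.translationGluing.smoothAt_chart_symm (i := m) (y := 1)
    (by simpa [translationGluing, translationChart] using h.one_mem_translationDomain)
  refine this.congr (Eventually.of_forall fun x => ?_)
  simp [translationGluing, translationChart]

theorem isLieGroup_manifold (h : A.IsLocallyLieGroup) : h.manifold.IsLieGroup := by
  constructor
  · refine smooth_of_smoothAt fun ⟨x, y⟩ => ?_
    have hx : (h.manifold.prod h.manifold).SmoothAt A
        (fun p => y⁻¹ * (x⁻¹ * p.1) * y⁻¹⁻¹) (x, y) :=
      (h.smoothAt_conj y⁻¹).comp_of_eq ((h.smoothAt_inv_mul x).comp_of_eq smoothAt_fst rfl)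
        (inv_mul_cancel x)
    have hy : (h.manifold.prod h.manifold).SmoothAt A (fun p => y⁻¹ * p.2) (x, y) :=
      (h.smoothAt_inv_mul y).comp_of_eq smoothAt_snd rfl
    have hxy := h.smoothAt_mul.comp_of_eq (hx.prodMk hy) (by simp)
    refine ((h.smoothAt_mul_left_one (x * y)).comp_of_eq hxy (by simp)).congr
      (Eventually.of_forall fun p => ?_)
    group
  · refine smooth_of_smoothAt fun x => ?_
    have hx : h.manifold.SmoothAt A (fun y => x * (x⁻¹ * y)⁻¹ * x⁻¹) x :=
      (h.smoothAt_conj x).comp_of_eq (h.smoothAt_inv.comp_of_eq (h.smoothAt_inv_mul x)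
        (inv_mul_cancel x)) (by simp)
    refine ((h.smoothAt_mul_left_one x⁻¹).comp_of_eq hx (by simp)).congr
      (Eventually.of_forall fun p => ?_)
    group

theorem exists_isLieGroup (h : A.IsLocallyLieGroup) :
    ∃ L : LCManifold.{u₁, w₁, v} 𝕜 G, L.IsLieGroup ∧
      A.SmoothAt L (fun x => x) 1 ∧ L.SmoothAt A (fun x => x) 1 :=
  ⟨h.manifold, h.isLieGroup_manifold, by simpa using h.smoothAt_mul_left_one 1,
    by simpa using h.smoothAt_inv_mul 1⟩

end IsLocallyLieGroup
end LCManifold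

/-! ### Principal bundles and extensions -/

section Bundles

open LCManifold

variable {𝕜 : Type u₁} [RCLike 𝕜]

section PrincipalBundle

variable {H : Type w₁} [Group H] {P : Type w₂} [Group P] {X : Type w₃} {X' : Type w₄}
  {A : LCManifold.{u₁, w₁, v} 𝕜 H} {B : LCManifold.{u₁, w₂, v} 𝕜 P}
  {C : LCManifold.{u₁, w₃, v} 𝕜 X} {C' : LCManifold.{u₁, w₄, v} 𝕜 X'}
  {i : H →* P} {π : P → X} {π' : P → X'}

namespace IsPrincipalBundle

theorem surjective (h : IsPrincipalBundle A B C i π) : Function.Surjective π := fun x => by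
  obtain ⟨V, -, hxV, s, -, hπs, -⟩ := h.locally_trivial x
  exact ⟨s x, hπs x hxV⟩

theorem exists_section (h : IsPrincipalBundle A B C i π) (hB : B.IsLieGroup) (p : P) :
    ∃ s : X → P, C.SmoothAt B s (π p) ∧ s (π p) = p ∧ ∀ᶠ y in C.nhds (π p), π (s y) = y := by
  obtain ⟨V, hV, hpV, s, hs, hπs, -⟩ := h.locally_trivial (π p)
  obtain ⟨k, hk⟩ := (h.fiber (s (π p)) p).1 (hπs _ hpV)
  refine ⟨fun y => s y * i k, hB.mul (hs.smoothAt hV hpV) smoothAt_const, hk.symm, ?_⟩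
  filter_upwards [hV.mem_nhds hpV] with y hy
  rw [← (h.fiber (s y) (s y * i k)).2 ⟨k, rfl⟩, hπs y hy]

theorem smoothAt_of_lift {M : Type w₄} {Y : Type w₅} {D : LCManifold.{u₁, w₄, v} 𝕜 M}
    {E : LCManifold.{u₁, w₅, v} 𝕜 Y} (h : IsPrincipalBundle A B C i π) (hB : B.IsLieGroup)
    {f : M → X → Y} {g : M → X} {m : M} {p : P} (hg : D.SmoothAt C g m) (hp : g m = π p)
    (hf : (D.prod B).SmoothAt E (fun z => f z.1 (π z.2)) (m, p)) :
    D.SmoothAt E (fun z => f z (g z)) m := by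
  obtain ⟨s, hs, hsp, hπs⟩ := h.exists_section hB p
  rw [← hp] at hs hsp hπs
  refine (hf.comp_of_eq (smoothAt_id.prodMk (hs.comp hg)) (Prod.ext rfl hsp)).congr ?_
  filter_upwards [hg.tendsto.eventually hπs] with z hz
  rw [hz]

theorem smooth_base {Y : Type w₅} {E : LCManifold.{u₁, w₅, v} 𝕜 Y}
    (h : IsPrincipalBundle A B C i π) (hB : B.IsLieGroup) {f : X → Y}
    (hf : B.Smooth E (fun p => f (π p))) : C.Smooth E f := by
  refine smooth_of_smoothAt fun x => ?_
  obtain ⟨p, rfl⟩ := h.surjective x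
  exact h.smoothAt_of_lift hB (f := fun _ => f) smoothAt_id rfl
    ((hf.smoothAt p).comp_of_eq smoothAt_snd rfl)

theorem diffeo_base {H' : Type w₅} [Group H'] {A' : LCManifold.{u₁, w₅, v} 𝕜 H'} {i' : H' →* P}
    (h : IsPrincipalBundle A B C i π) (h' : IsPrincipalBundle A' B C' i' π') (hB : B.IsLieGroup)
    (e : X ≃ X') (he : ∀ p, e (π p) = π' p) : C.Diffeo C' e := by
  refine ⟨h.smooth_base hB ?_, h'.smooth_base hB ?_⟩
  · simpa only [he] using h'.smooth_proj
  · simpa only [← he, e.symm_apply_apply] using h.smooth_proj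

theorem transport {H' : Type w₅} [Group H'] {A' : LCManifold.{u₁, w₅, v} 𝕜 H'} {i' : H' →* P}
    (h : IsPrincipalBundle A B C i π) (e : H' ≃* H) (he : A'.Diffeo A e.toEquiv)
    (f : X' ≃ X) (hf : C'.Diffeo C f) (hi : ∀ x, i' x = i (e x)) (hπ : ∀ p, f (π' p) = π p) :
    IsPrincipalBundle A' B C' i' π' where
  smooth_incl := smooth_of_smoothAt fun x =>
    ((h.smooth_incl.smoothAt _).comp (he.1.smoothAt x)).congr (Eventually.of_forall hi)
  smooth_proj := smooth_of_smoothAt fun p =>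
    ((hf.2.smoothAt _).comp (h.smooth_proj.smoothAt p)).congr
      (Eventually.of_forall fun y => by rw [← hπ, f.symm_apply_apply])
  free x y hxy := e.injective (h.free (by rw [← hi, ← hi, hxy]))
  fiber p p' := by
    rw [← f.injective.eq_iff, hπ, hπ, h.fiber, e.surjective.exists]
    simp only [hi]
  locally_trivial x := by
    obtain ⟨V, hV, hxV, s, hs, hπs, d, hd, hsd⟩ := h.locally_trivial (f x)
    have hpre : π' ⁻¹' (f ⁻¹' V) = π ⁻¹' V := by
      ext p
      simp only [mem_preimage, hπ]
    refine ⟨f ⁻¹' V, hf.1.isOpenSet_preimage hV, hxV, fun y => s (f y), ?_, fun y hy => ?_,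
      fun p => e.symm (d p), ?_, fun p hp => ?_⟩
    · exact smoothOn_of_smoothAt fun y hy => (hs.smoothAt hV hy).comp (hf.1.smoothAt y)
    · exact f.injective (by rw [hπ, hπs _ hy])
    · rw [hpre]
      exact smoothOn_of_smoothAt fun p hp => (he.2.smoothAt _).comp
        (hd.smoothAt (h.smooth_proj.isOpenSet_preimage hV) hp)
    · beta_reduce
      rw [hi, e.apply_symm_apply, hπ]
      exact hsd p (by rw [← hπ]; exact hp)

end IsPrincipalBundle
end PrincipalBundle

section Extension

variable {N : Type w₁} [Group N] {P : Type w₂} [Group P] {G : Type w₃} [Group G]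
  {A : LCManifold.{u₁, w₁, v} 𝕜 N} {B : LCManifold.{u₁, w₂, v} 𝕜 P}
  {C : LCManifold.{u₁, w₃, v} 𝕜 G} {i : N →* P} {q : P →* G}

theorem exists_isOpenSet_smoothOn_section (hB : B.IsLieGroup) (hC : C.IsLieGroup) {s : G → P}
    (hs : C.SmoothAt B s 1) (hqs : Function.RightInverse s q) (x : G) :
    ∃ V : Set G, C.IsOpenSet V ∧ x ∈ V ∧
      ∃ t : G → P, C.SmoothOn B t V ∧ Function.RightInverse t q := by
  have htranslate (y : G) : C.SmoothAt C (fun y => x⁻¹ * y) y := hC.mul smoothAt_const smoothAt_id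
  have ht : C.SmoothAt B (fun y => s x * s (x⁻¹ * y)) x :=
    hB.mul smoothAt_const (hs.comp_of_eq (htranslate x) (inv_mul_cancel x))
  obtain ⟨V, hV, hxV, htV⟩ := ht
  exact ⟨V, hV, hxV, _, htV, fun y => by rw [map_mul, hqs, hqs, mul_inv_cancel_left]⟩

theorem isLieExtension_of_section (hA : A.IsLieGroup) (hB : B.IsLieGroup) (hC : C.IsLieGroup)
    (hi : A.SmoothAt B i 1) (hq : B.SmoothAt C q 1) (hexact : i.range = q.ker)
    {s : G → P} (hs : C.SmoothAt B s 1) (hqs : Function.RightInverse s q)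
    {r : P → N} (hr : B.SmoothAt A r 1) (hri : Function.LeftInverse r i) :
    IsLieExtension A B C i q := by
  have hqB : B.Smooth C q := hB.smooth_hom hC q hq
  have hdiff (p p' : P) : q p = q p' ↔ ∃ n, p' = p * i n := by
    rw [← inv_mul_eq_one, ← map_inv, ← map_mul, ← MonoidHom.mem_ker, ← hexact]
    simp only [MonoidHom.mem_range, eq_inv_mul_iff_mul_eq, eq_comm (b := p')]
  refine ⟨hA, hB, hC, ⟨hA.smooth_hom hB i hi, hqB, hri.injective, hdiff, fun x => ?_⟩⟩
  obtain ⟨V, hV, hxV, t, ht, hqt⟩ := exists_isOpenSet_smoothOn_section hB hC hs hqs x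
  choose d hd using fun p => (hdiff (t (q p)) p).1 (hqt (q p))
  refine ⟨V, hV, hxV, t, ht, fun y _ => hqt y, d, smoothOn_of_smoothAt fun p hp => ?_,
    fun p _ => hd p⟩
  refine hA.smoothAt_of_hom_comp hB hr hri ?_
  have htp : B.SmoothAt B (fun p => (t (q p))⁻¹ * p) p :=
    hB.mul (hB.inv ((ht.smoothAt hV hp).comp (hqB.smoothAt p))) smoothAt_id
  exact htp.congr (Eventually.of_forall fun p => eq_inv_mul_of_mul_eq (hd p).symm)

namespace IsLieExtension

theorem range_eq_ker (h : IsLieExtension A B C i q) : i.range = q.ker := by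
  ext p
  rw [MonoidHom.mem_ker, MonoidHom.mem_range, ← map_one q, eq_comm, h.bundle.fiber]
  simp only [one_mul, eq_comm]

theorem exists_splitLieSubgroup (h : IsLieExtension A B C i q) {R : Subgroup P}
    (hR : R = q.ker) : ∃ (I : SplitLieSubgroup B R) (e : R ≃* N),
      (∀ x, i (e x) = x) ∧ I.sub.Diffeo A e.toEquiv := by
  subst hR
  let e : q.ker ≃* N :=
    ((MonoidHom.ofInjective h.bundle.free).trans (MulEquiv.subgroupCongr h.range_eq_ker)).symm
  have he (x : q.ker) : i (e x) = x := congrArg Subtype.val (e.symm_apply_apply x)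
  let f : P ⧸ q.ker ≃* G := QuotientGroup.quotientKerEquivOfSurjective q h.bundle.surjective
  have hsub := A.diffeo_comap e.toEquiv
  have hquot := C.diffeo_comap f.toEquiv
  exact ⟨⟨_, h.lie_kernel.of_diffeo e hsub, _, h.bundle.transport e hsub f.toEquiv hquot
    (fun x => (he x).symm) fun _ => rfl⟩, e, he, hsub⟩

theorem exists_quotient_equiv (h : IsLieExtension A B C i q) {R : Subgroup P}
    (hR : R = q.ker) : ∃ (_ : R.Normal) (e : P ⧸ R ≃* G),
      (∀ x : P, e (x : P ⧸ R) = q x) ∧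
        ∀ I : SplitLieSubgroup B R, I.quot.Diffeo C e.toEquiv := by
  subst hR
  exact ⟨inferInstance, QuotientGroup.quotientKerEquivOfSurjective q h.bundle.surjective,
    fun _ => rfl, fun I => I.bundle.diffeo_base h.bundle h.lie_total _ fun _ => rfl⟩

theorem exists_splitLieSubgroup_comp {K : Type w₄} [Group K] {Q : Type w₅} [Group Q]
    {D : LCManifold.{u₁, w₄, v} 𝕜 K} {E : LCManifold.{u₁, w₅, v} 𝕜 Q} {k : K →* Q} {π : Q →* N}
    (h : IsLieExtension A B C i q) (h' : IsLieExtension D E A k π) :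
    ∃ (J : SplitLieSubgroup E (i.comp π).ker) (I : SplitLieSubgroup B (i.comp π).range),
      J.quot.Diffeo I.sub (QuotientGroup.quotientKerEquivRange (i.comp π)).toEquiv := by
  have hker : (i.comp π).ker = π.ker := MonoidHom.ker_comp_of_injective π i h.bundle.free
  have hrange : (i.comp π).range = q.ker := by
    rw [MonoidHom.range_comp, MonoidHom.range_eq_top.2 h'.bundle.surjective,
      ← MonoidHom.range_eq_map, h.range_eq_ker]
  obtain ⟨J, -⟩ := h'.exists_splitLieSubgroup hker
  obtain ⟨I, e, he, hI⟩ := h.exists_splitLieSubgroup hrange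
  refine ⟨J, I, ?_⟩
  set f := (QuotientGroup.quotientKerEquivRange (i.comp π)).toEquiv
  have hJ : J.quot.Diffeo A (f.trans e.toEquiv) :=
    J.bundle.diffeo_base h'.bundle h'.lie_total _ fun x => h.bundle.free (he (f x))
  simpa only [Equiv.trans_assoc, Equiv.self_trans_symm, Equiv.trans_refl] using hJ.trans hI.symm

end IsLieExtension

namespace SplitLieSubgroup

variable {K : Subgroup P} [K.Normal]

theorem isLieGroup_quot (Z : SplitLieSubgroup B K) (hB : B.IsLieGroup) :
    Z.quot.IsLieGroup := by
  constructor
  · refine smooth_of_smoothAt fun ⟨a, b⟩ => ?_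
    obtain ⟨x, rfl⟩ := Z.bundle.surjective a
    obtain ⟨y, rfl⟩ := Z.bundle.surjective b
    refine Z.bundle.smoothAt_of_lift hB (m := (↑x, ↑y)) (p := x) (f := fun z a => a * z.2)
      smoothAt_fst rfl ?_
    refine Z.bundle.smoothAt_of_lift hB (D := (Z.quot.prod Z.quot).prod B) (p := y)
      (f := fun z b => (z.2 : P ⧸ K) * b) (smoothAt_snd.comp_of_eq smoothAt_fst rfl) rfl ?_
    exact (Z.bundle.smooth_proj.smoothAt (x * y)).comp_of_eq
      (hB.mul (smoothAt_snd.comp_of_eq smoothAt_fst rfl) smoothAt_snd) rfl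
  · exact Z.bundle.smooth_base hB (smooth_of_smoothAt fun x =>
      (Z.bundle.smooth_proj.smoothAt _).comp (hB.smooth_inv.smoothAt x))

theorem isLieExtension (Z : SplitLieSubgroup B K) (hB : B.IsLieGroup) :
    IsLieExtension Z.sub B Z.quot K.subtype (QuotientGroup.mk' K) :=
  ⟨Z.sub_lie, hB, Z.isLieGroup_quot hB, Z.bundle⟩

end SplitLieSubgroup
end Extension
end Bundles

/-! ### Outer actions -/

section OuterActions

open LCManifold

variable {𝕜 : Type u₁} [RCLike 𝕜]

section Automorphisms

variable {G : Type w₁} [Group G] {N : Type w₂} [Group N]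
  {A : LCManifold.{u₁, w₁, v} 𝕜 G} {B : LCManifold.{u₁, w₂, v} 𝕜 N}

theorem conj_mulAut_apply (φ : MulAut N) (n : N) :
    MulAut.conj (φ n) = φ * MulAut.conj n * φ⁻¹ := by
  ext m
  simp

theorem IsLieAut.mul {φ ψ : MulAut N} (hφ : IsLieAut B φ) (hψ : IsLieAut B ψ) :
    IsLieAut B (φ * ψ) :=
  Diffeo.trans hψ hφ

theorem isLieAut_conj (hB : B.IsLieGroup) (n : N) : IsLieAut B (MulAut.conj n) := by
  have hconj (n : N) : B.Smooth B (MulAut.conj n) := smooth_of_smoothAt fun m =>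
    hB.mul (hB.mul smoothAt_const smoothAt_id) smoothAt_const
  refine ⟨hconj n, ?_⟩
  have hinv := hconj n⁻¹
  rwa [map_inv] at hinv

theorem isSmoothAction_of_smoothAt (hA : A.IsLieGroup) {r : G →* MulAut N}
    (haut : ∀ g, IsLieAut B (r g))
    (hr : ∀ n, (A.prod B).SmoothAt B (fun p => r p.1 p.2) (1, n)) : IsSmoothAction A B r := by
  refine ⟨haut, smooth_of_smoothAt fun ⟨g, n⟩ => ?_⟩
  have htranslate : (A.prod B).SmoothAt B (fun p => r (g⁻¹ * p.1) p.2) (g, n) :=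
    (hr n).comp_of_eq ((hA.mul smoothAt_const smoothAt_fst).prodMk smoothAt_snd)
      (Prod.ext (inv_mul_cancel g) rfl)
  refine (((haut g).1.smoothAt _).comp htranslate).congr (Eventually.of_forall fun p => ?_)
  change r p.1 p.2 = (r g * r (g⁻¹ * p.1)) p.2
  rw [← map_mul, mul_inv_cancel_left]

theorem smooth_conjAd (hB : B.IsLieGroup) (Z : SplitLieSubgroup B (Subgroup.center N)) :
    (Z.quot.prod B).Smooth B (fun p => conjAd p.1 p.2) := by
  refine smooth_of_smoothAt fun ⟨a, n⟩ => ?_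
  obtain ⟨m, rfl⟩ := Z.bundle.surjective a
  refine Z.bundle.smoothAt_of_lift hB (D := Z.quot.prod B) (p := m)
    (f := fun p a => conjAd a p.2) smoothAt_fst rfl ?_
  exact hB.mul (hB.mul smoothAt_snd (smoothAt_snd.comp_of_eq smoothAt_fst rfl))
    (hB.inv smoothAt_snd)

theorem IsCochain₁.smoothAt {f : G → N} (h : IsCochain₁ A B f) : A.SmoothAt B f 1 :=
  h.2

theorem IsCochain₂.smoothAt {ω : G × G → N} (h : IsCochain₂ A B ω) :
    (A.prod A).SmoothAt B ω (1, 1) :=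
  h.2.2

theorem IsCochain₂ss.smoothAt {ω : G × G → N} (h : IsCochain₂ss A B ω) (g : G) :
    A.SmoothAt B (fun x => ω (g, x) * (ω (g * x * g⁻¹, g))⁻¹) 1 :=
  h.2 g

/-- If `δ_φ = C_N ∘ ω`, then this is the cochain which describes `δ` of `(C_N ∘ h) · φ`, see
`delta_conj_mul`. -/
def twistCochain (φ : G → MulAut N) (h : G → N) (ω : G × G → N) (p : G × G) : N :=
  h p.1 * φ p.1 (h p.2) * ω p * (h (p.1 * p.2))⁻¹

theorem delta_conj_mul {φ : G → MulAut N} {ω : G × G → N}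
    (hω : ∀ g g', delta φ g g' = MulAut.conj (ω (g, g'))) (h : G → N) (g g' : G) :
    delta (fun g => MulAut.conj (h g) * φ g) g g' =
      MulAut.conj (twistCochain φ h ω (g, g')) := by
  simp only [twistCochain, map_mul, map_inv, ← hω, conj_mulAut_apply, delta]
  group

end Automorphisms

namespace SmoothOuterAction

variable {G : Type u₂} [Group G] {N : Type u₃} [Group N]
  {A : LCManifold.{u₁, u₂, v} 𝕜 G} {B : LCManifold.{u₁, u₃, v} 𝕜 N}
  {S S' : SmoothOuterAction A B} {ω : G × G → N} {h : G → N}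

theorem smoothAt_apply (S : SmoothOuterAction A B) (n : N) :
    (A.prod B).SmoothAt B (fun p => S.toFun p.1 p.2) (1, n) := by
  obtain ⟨U, hU, h1, hS⟩ := S.locally_smooth
  exact hS.smoothAt (hU.prod isOpenSet_univ) ⟨h1, mem_univ n⟩

theorem isCochain₂_twistCochain (hA : A.IsLieGroup) (hB : B.IsLieGroup)
    (S : SmoothOuterAction A B) (hh : IsCochain₁ A B h) (hω : IsCochain₂ A B ω) :
    IsCochain₂ A B (twistCochain S.toFun h ω) := by
  refine ⟨fun g => ?_, fun g => ?_, ?_⟩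
  · simp [twistCochain, hh.1, S.normalized, hω.1]
  · simp [twistCochain, hh.1, hω.2.1]
  have hfst : (A.prod A).SmoothAt B (fun p => h p.1) (1, 1) :=
    hh.smoothAt.comp_of_eq smoothAt_fst rfl
  have hsnd : (A.prod A).SmoothAt B (fun p => h p.2) (1, 1) :=
    hh.smoothAt.comp_of_eq smoothAt_snd rfl
  have hmul : (A.prod A).SmoothAt B (fun p => h (p.1 * p.2)) (1, 1) :=
    hh.smoothAt.comp_of_eq (hA.mul smoothAt_fst smoothAt_snd) (one_mul 1)
  have hact : (A.prod A).SmoothAt B (fun p => S.toFun p.1 (h p.2)) (1, 1) :=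
    (S.smoothAt_apply _).comp_of_eq (smoothAt_fst.prodMk hsnd) rfl
  exact hB.mul (hB.mul (hB.mul hfst hact) hω.smoothAt) (hB.inv hmul)

theorem isCochain₂ss_twistCochain (hA : A.IsLieGroup) (hB : B.IsLieGroup)
    (S : SmoothOuterAction A B) (hh : IsCochain₁ A B h) (hω : IsCochain₂ss A B ω) :
    IsCochain₂ss A B (twistCochain S.toFun h ω) := by
  refine ⟨isCochain₂_twistCochain hA hB S hh hω.1, fun g => ?_⟩
  have hconj : A.SmoothAt A (fun x => g * x * g⁻¹) 1 :=
    hA.mul (hA.mul smoothAt_const smoothAt_id) smoothAt_const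
  have hh_conj : A.SmoothAt B (fun x => h (g * x * g⁻¹)) 1 :=
    hh.smoothAt.comp_of_eq hconj (by simp)
  have hact : A.SmoothAt B (fun x => S.toFun g (h x)) 1 :=
    ((S.lieAut g).1.smoothAt _).comp hh.smoothAt
  have hact_conj : A.SmoothAt B (fun x => S.toFun (g * x * g⁻¹) (h g)) 1 :=
    (S.smoothAt_apply (h g)).comp_of_eq (hconj.prodMk smoothAt_const) (by simp)
  -- The factors `h (g x)⁻¹` and `h (g x g⁻¹ g)` of the two twisted cochains cancel.
  have hprod : A.SmoothAt B (fun x => h g * S.toFun g (h x) *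
      (ω (g, x) * (ω (g * x * g⁻¹, g))⁻¹) * (S.toFun (g * x * g⁻¹) (h g))⁻¹ *
      (h (g * x * g⁻¹))⁻¹) 1 :=
    hB.mul (hB.mul (hB.mul (hB.mul smoothAt_const hact) (hω.smoothAt g)) (hB.inv hact_conj))
      (hB.inv hh_conj)
  refine hprod.congr (Eventually.of_forall fun x => ?_)
  simp only [twistCochain, inv_mul_cancel_right]
  group

theorem Equivalent.isStronglySmooth (hA : A.IsLieGroup) (hB : B.IsLieGroup)
    (h : S.Equivalent S') (hS : S.IsStronglySmooth) : S'.IsStronglySmooth := by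
  obtain ⟨h, hh, hS'⟩ := h
  obtain ⟨ω, hω, hδ⟩ := hS
  refine ⟨_, isCochain₂ss_twistCochain hA hB S hh hω, ?_⟩
  rw [funext hS']
  exact delta_conj_mul hδ h

theorem deltaAd_eq (hω : ∀ g g', delta S.toFun g g' = MulAut.conj (ω (g, g'))) (g g' : G) :
    S.deltaAd g g' = (ω (g, g') : N ⧸ Subgroup.center N) :=
  conjAd_injective (by rw [conjAd_deltaAd, hω]; rfl)

section Center

variable (Z : SplitLieSubgroup B (Subgroup.center N)) {M : Type w₁}
  {D : LCManifold.{u₁, w₁, v} 𝕜 M} {m : M} {f f' : M → G}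

theorem smoothAt_actAd (hB : B.IsLieGroup) (S : SmoothOuterAction A B)
    {a : M → N ⧸ Subgroup.center N} (hf : D.SmoothAt A f m) (ha : D.SmoothAt Z.quot a m)
    (hm : f m = 1) : D.SmoothAt Z.quot (fun y => S.actAd (f y) (a y)) m := by
  obtain ⟨n, hn⟩ := Z.bundle.surjective (a m)
  refine Z.bundle.smoothAt_of_lift hB (f := fun y a => S.actAd (f y) a) ha hn.symm ?_
  exact (Z.bundle.smooth_proj.smoothAt _).comp ((S.smoothAt_apply n).comp_of_eq
    ((hf.comp_of_eq smoothAt_fst rfl).prodMk smoothAt_snd) (Prod.ext hm rfl))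

theorem smooth_actAd (hB : B.IsLieGroup) (S : SmoothOuterAction A B) (g : G) :
    Z.quot.Smooth Z.quot (S.actAd g) :=
  Z.bundle.smooth_base hB (smooth_of_smoothAt fun n =>
    (Z.bundle.smooth_proj.smoothAt _).comp ((S.lieAut g).1.smoothAt n))

theorem smoothAt_deltaAd (S : SmoothOuterAction A B) (hf : D.SmoothAt A f m)
    (hf' : D.SmoothAt A f' m) (hm : f m = 1) (hm' : f' m = 1) :
    D.SmoothAt Z.quot (fun y => S.deltaAd (f y) (f' y)) m := by
  obtain ⟨ω, hω, hδ⟩ := S.outer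
  exact ((Z.bundle.smooth_proj.smoothAt _).comp
    (hω.smoothAt.comp_of_eq (hf.prodMk hf') (Prod.ext hm hm'))).congr
    (Eventually.of_forall fun y => deltaAd_eq hδ _ _)

theorem IsStronglySmooth.smoothAt_deltaAd (hS : S.IsStronglySmooth) (g : G) :
    A.SmoothAt Z.quot (fun x => S.deltaAd g x * (S.deltaAd (g * x * g⁻¹) g)⁻¹) 1 := by
  obtain ⟨ω, hω, hδ⟩ := hS
  refine ((Z.bundle.smooth_proj.smoothAt _).comp (hω.smoothAt g)).congr
    (Eventually.of_forall fun x => ?_)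
  rw [deltaAd_eq hδ, deltaAd_eq hδ]
  rfl

end Center
end SmoothOuterAction
end OuterActions

/-! ### The Lie group `G^S` -/

section LieGroupGS

open LCManifold

variable {𝕜 : Type u₁} [RCLike 𝕜]

namespace SmoothOuterAction.GS

variable {G : Type u₂} [Group G] {N : Type u₃} [Group N]
  {A : LCManifold.{u₁, u₂, v} 𝕜 G} {B : LCManifold.{u₁, u₃, v} 𝕜 N}
  {S S' : SmoothOuterAction A B}

/-- The homomorphism `ρ : (C_N(n), g) ↦ C_N(n) S(g)`. -/
noncomputable def toAut (S : SmoothOuterAction A B) : S.GS →* MulAut N where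
  toFun x := conjAd x.ad * S.toFun x.base
  map_one' := by simp [one_def, S.normalized]
  map_mul' := conjAd_mul

/-- The section `σ : g ↦ (1, g)` of `q_S`. -/
def sec (S : SmoothOuterAction A B) (g : G) : S.GS :=
  ⟨1, g⟩

/-- The homomorphism `α : n ↦ (C_N(n), 1)`. -/
noncomputable def alpha (S : SmoothOuterAction A B) : N →* S.GS :=
  (incl S).comp (QuotientGroup.mk' (Subgroup.center N))

theorem toAut_apply (x : S.GS) : toAut S x = conjAd x.ad * S.toFun x.base := rfl

theorem toAut_mk (a : N ⧸ Subgroup.center N) (g : G) :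
    toAut S ⟨a, g⟩ = conjAd a * S.toFun g := rfl

theorem toAut_mk_coe (n : N) (g : G) :
    toAut S ⟨(n : N ⧸ Subgroup.center N), g⟩ = MulAut.conj n * S.toFun g := rfl

theorem alpha_apply (n : N) : alpha S n = ⟨(n : N ⧸ Subgroup.center N), 1⟩ := rfl

theorem toAut_incl (a : N ⧸ Subgroup.center N) : toAut S (incl S a) = conjAd a := by
  simp [toAut_apply, incl, S.normalized]

theorem toAut_sec (g : G) : toAut S (sec S g) = S.toFun g := by
  simp [toAut_apply, sec]

theorem toAut_alpha (n : N) : toAut S (alpha S n) = MulAut.conj n :=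
  toAut_incl _

theorem ext_toAut {x y : S.GS} (hbase : proj S x = proj S y) (h : toAut S x = toAut S y) : x = y :=
  ext_conjAd hbase h

theorem incl_mul_sec (a : N ⧸ Subgroup.center N) (g : G) : incl S a * sec S g = ⟨a, g⟩ :=
  ext_toAut (one_mul g) (by rw [map_mul, toAut_incl, toAut_sec, toAut_mk])

theorem incl_conj (a b : N ⧸ Subgroup.center N) (u : G) :
    incl S a * ⟨b, u⟩ * (incl S a)⁻¹ = ⟨a * b * S.actAd u a⁻¹, u⟩ := by
  rw [mul_inv_eq_iff_eq_mul]
  refine ext_toAut ((one_mul u).trans (mul_one u).symm) ?_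
  simp only [map_mul, toAut_incl, toAut_mk, conjAd_actAd, map_inv]
  group

theorem sec_conj (g u : G) (b : N ⧸ Subgroup.center N) :
    sec S g * ⟨b, u⟩ * (sec S g)⁻¹ =
      ⟨S.actAd g b * (S.deltaAd g u * (S.deltaAd (g * u * g⁻¹) g)⁻¹), g * u * g⁻¹⟩ := by
  rw [mul_inv_eq_iff_eq_mul]
  refine ext_toAut (inv_mul_cancel_right (g * u) g).symm ?_
  simp only [map_mul, map_inv, toAut_sec, toAut_mk, conjAd_actAd, conjAd_deltaAd, delta,
    inv_mul_cancel_right]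
  group

theorem incl_injective : Function.Injective (incl S) := fun _ _ h => congrArg GS.ad h

theorem range_incl : (incl S).range = (proj S).ker := by
  ext x
  refine ⟨?_, fun hx => ⟨x.ad, GS.ext rfl hx.symm⟩⟩
  rintro ⟨a, rfl⟩
  rfl

theorem ker_alpha : (alpha S).ker = Subgroup.center N :=
  (MonoidHom.ker_comp_of_injective _ _ incl_injective).trans (QuotientGroup.ker_mk' _)

theorem range_alpha : (alpha S).range = (incl S).range := by
  rw [alpha, MonoidHom.range_comp, QuotientGroup.range_mk', MonoidHom.range_eq_map]

theorem mk_mul_mk {ω : G × G → N}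
    (hω : ∀ g g', delta S.toFun g g' = MulAut.conj (ω (g, g'))) (n n' : N) (g g' : G) :
    (⟨(n : N ⧸ Subgroup.center N), g⟩ * ⟨(n' : N ⧸ Subgroup.center N), g'⟩ : S.GS) =
      ⟨((n * S.toFun g n' * ω (g, g') : N) : N ⧸ Subgroup.center N), g * g'⟩ := by
  rw [mul_def, deltaAd_eq hω]
  rfl

theorem alpha_eq_delta_sec {ω : G × G → N}
    (hω : ∀ g g', delta S.toFun g g' = MulAut.conj (ω (g, g'))) (g g' : G) :
    alpha S (ω (g, g')) = delta (sec S) g g' := by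
  rw [delta, eq_mul_inv_iff_mul_eq]
  refine ext_toAut (one_mul (g * g')) ?_
  simp only [map_mul, toAut_alpha, toAut_sec, ← hω, delta, inv_mul_cancel_right]

theorem alpha_toAut (x : S.GS) (n : N) : alpha S (toAut S x n) = x * alpha S n * x⁻¹ := by
  rw [eq_mul_inv_iff_mul_eq]
  refine ext_toAut ((one_mul x.base).trans (mul_one x.base).symm) ?_
  rw [map_mul, map_mul, toAut_alpha, toAut_alpha, conj_mulAut_apply, inv_mul_cancel_right]

/-! ### Product coordinates near the identity -/

/-- The bijection from `G^S` to the set `N_ad × G` of which it consists. -/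
def coords (S : SmoothOuterAction A B) : S.GS ≃ (N ⧸ Subgroup.center N) × G where
  toFun x := (x.ad, x.base)
  invFun p := ⟨p.1, p.2⟩
  left_inv _ := rfl
  right_inv _ := rfl

/-- The manifold structure of `N_ad × G` on the set `G^S`. In general, it agrees with the Lie group
structure of `G^S` only near the identity. -/
noncomputable def productManifold (S : SmoothOuterAction A B)
    (Q : LCManifold.{u₁, u₃, v} 𝕜 (N ⧸ Subgroup.center N)) :
    LCManifold.{u₁, max u₂ u₃, v} 𝕜 S.GS :=
  (Q.prod A).comap (coords S)

section ProductManifold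

variable {Q : LCManifold.{u₁, u₃, v} 𝕜 (N ⧸ Subgroup.center N)}
  {M : Type w₁} {D : LCManifold.{u₁, w₁, v} 𝕜 M}

theorem smoothAt_productManifold_iff {f : M → S.GS} {m : M} :
    D.SmoothAt (productManifold S Q) f m ↔
      D.SmoothAt Q (fun y => (f y).ad) m ∧ D.SmoothAt A (fun y => (f y).base) m := by
  have hcoords := (Q.prod A).diffeo_comap (coords S)
  refine ⟨fun hf => ?_, fun hf => (hcoords.2.smoothAt _).comp (hf.1.prodMk hf.2)⟩
  have hpair := (hcoords.1.smoothAt (f m)).comp hf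
  exact ⟨hpair.fst, hpair.snd⟩

theorem smoothAt_ad {x : S.GS} : (productManifold S Q).SmoothAt Q GS.ad x :=
  (smoothAt_productManifold_iff.1 smoothAt_id).1

theorem smoothAt_base {x : S.GS} : (productManifold S Q).SmoothAt A GS.base x :=
  (smoothAt_productManifold_iff (Q := Q).1 smoothAt_id).2

end ProductManifold

section LocallyLie

variable (Z : SplitLieSubgroup B (Subgroup.center N))

theorem smoothAt_mul (hA : A.IsLieGroup) (hB : B.IsLieGroup) :
    ((productManifold S Z.quot).prod (productManifold S Z.quot)).SmoothAt
      (productManifold S Z.quot) (fun p => p.1 * p.2) ((1, 1) : S.GS × S.GS) := by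
  set L := productManifold S Z.quot
  have hZ := Z.isLieGroup_quot hB
  have had : (L.prod L).SmoothAt Z.quot (fun p => p.1.ad) (1, 1) :=
    smoothAt_ad.comp_of_eq smoothAt_fst rfl
  have hbase : (L.prod L).SmoothAt A (fun p => p.1.base) (1, 1) :=
    (smoothAt_base (Q := Z.quot)).comp_of_eq smoothAt_fst rfl
  have had' : (L.prod L).SmoothAt Z.quot (fun p => p.2.ad) (1, 1) :=
    smoothAt_ad.comp_of_eq smoothAt_snd rfl
  have hbase' : (L.prod L).SmoothAt A (fun p => p.2.base) (1, 1) :=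
    (smoothAt_base (Q := Z.quot)).comp_of_eq smoothAt_snd rfl
  have hact : (L.prod L).SmoothAt Z.quot (fun p => S.actAd p.1.base p.2.ad) (1, 1) :=
    smoothAt_actAd Z hB S hbase had' rfl
  have hdelta : (L.prod L).SmoothAt Z.quot (fun p => S.deltaAd p.1.base p.2.base) (1, 1) :=
    smoothAt_deltaAd Z S hbase hbase' rfl rfl
  have hmul : (L.prod L).SmoothAt Z.quot
      (fun p => p.1.ad * S.actAd p.1.base p.2.ad * S.deltaAd p.1.base p.2.base) (1, 1) :=
    hZ.mul (hZ.mul had hact) hdelta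
  exact smoothAt_productManifold_iff.2 ⟨hmul, hA.mul hbase hbase'⟩

theorem smoothAt_inv (hA : A.IsLieGroup) (hB : B.IsLieGroup) :
    (productManifold S Z.quot).SmoothAt (productManifold S Z.quot) (fun x => x⁻¹) (1 : S.GS) := by
  set L := productManifold S Z.quot
  have hZ := Z.isLieGroup_quot hB
  have hbase : L.SmoothAt A GS.base 1 := smoothAt_base
  have hbase_inv : L.SmoothAt A (fun x => x.base⁻¹) 1 := hA.inv hbase
  have hdelta : L.SmoothAt Z.quot (fun x => S.deltaAd x.base⁻¹ x.base) 1 :=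
    smoothAt_deltaAd Z S hbase_inv hbase inv_one rfl
  have hact : L.SmoothAt Z.quot (fun x => S.actAd x.base⁻¹ x.ad) 1 :=
    smoothAt_actAd Z hB S hbase_inv smoothAt_ad inv_one
  exact smoothAt_productManifold_iff.2 ⟨hZ.mul (hZ.inv hdelta) (hZ.inv hact), hbase_inv⟩

theorem smoothAt_incl_conj (hB : B.IsLieGroup) (a : N ⧸ Subgroup.center N) :
    (productManifold S Z.quot).SmoothAt (productManifold S Z.quot)
      (fun x => incl S a * x * (incl S a)⁻¹) 1 := by
  have hZ := Z.isLieGroup_quot hB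
  have hact : (productManifold S Z.quot).SmoothAt Z.quot (fun x => S.actAd x.base a⁻¹) 1 :=
    smoothAt_actAd Z hB S smoothAt_base smoothAt_const rfl
  refine (smoothAt_productManifold_iff
    (f := fun x : S.GS => ⟨a * x.ad * S.actAd x.base a⁻¹, x.base⟩).2
    ⟨hZ.mul (hZ.mul smoothAt_const smoothAt_ad) hact, smoothAt_base⟩).congr ?_
  exact Eventually.of_forall fun x => incl_conj a x.ad x.base

theorem smoothAt_sec_conj (hA : A.IsLieGroup) (hB : B.IsLieGroup) (hS : S.IsStronglySmooth)
    (g : G) :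
    (productManifold S Z.quot).SmoothAt (productManifold S Z.quot)
      (fun x => sec S g * x * (sec S g)⁻¹) 1 := by
  set L := productManifold S Z.quot
  have hact : L.SmoothAt Z.quot (fun x => S.actAd g x.ad) 1 :=
    ((smooth_actAd Z hB S g).smoothAt _).comp smoothAt_ad
  have hdelta : L.SmoothAt Z.quot
      (fun x => S.deltaAd g x.base * (S.deltaAd (g * x.base * g⁻¹) g)⁻¹) 1 :=
    (hS.smoothAt_deltaAd Z g).comp_of_eq smoothAt_base rfl
  have hconj : L.SmoothAt A (fun x => g * x.base * g⁻¹) 1 :=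
    hA.mul (hA.mul smoothAt_const smoothAt_base) smoothAt_const
  have had := (Z.isLieGroup_quot hB).mul hact hdelta
  have hmk : L.SmoothAt L (fun x => (⟨S.actAd g x.ad * (S.deltaAd g x.base *
      (S.deltaAd (g * x.base * g⁻¹) g)⁻¹), g * x.base * g⁻¹⟩ : S.GS)) 1 :=
    smoothAt_productManifold_iff.2 ⟨had, hconj⟩
  exact hmk.congr (Eventually.of_forall fun x => sec_conj g x.base x.ad)

theorem isLocallyLieGroup_productManifold (hA : A.IsLieGroup) (hB : B.IsLieGroup)
    (hS : S.IsStronglySmooth) : (productManifold S Z.quot).IsLocallyLieGroup where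
  smoothAt_mul := smoothAt_mul Z hA hB
  smoothAt_inv := smoothAt_inv Z hA hB
  smoothAt_conj k := by
    have hk : incl S k.ad * sec S k.base = k := incl_mul_sec k.ad k.base
    refine ((smoothAt_incl_conj Z hB k.ad).comp_of_eq (smoothAt_sec_conj Z hA hB hS k.base)
      (by group)).congr (Eventually.of_forall fun x => ?_)
    conv_lhs => rw [← hk]
    group

end LocallyLie

/-! ### Natural Lie group structures -/

section Natural

variable {Q : LCManifold.{u₁, u₃, v} 𝕜 (N ⧸ Subgroup.center N)}
  {L : LCManifold.{u₁, max u₂ u₃, v} 𝕜 S.GS}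

theorem isNatural_of_smoothAt (hA : A.IsLieGroup) (hQ : Q.IsLieGroup) (hL : L.IsLieGroup)
    (hmk : (Q.prod A).SmoothAt L (fun p => (⟨p.1, p.2⟩ : S.GS)) (1, 1))
    (hcoords : L.SmoothAt (Q.prod A) (fun x => (x.ad, x.base)) 1) : IsNatural S Q L := by
  have hincl : Q.Smooth L (incl S) :=
    hQ.smooth_hom hL _ (hmk.comp_of_eq (smoothAt_id.prodMk smoothAt_const) rfl)
  have hproj : L.Smooth A (proj S) := hL.smooth_hom hA _ hcoords.snd
  have hsec : A.SmoothAt L (sec S) 1 := hmk.comp_of_eq (smoothAt_const.prodMk smoothAt_id) rfl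
  obtain ⟨U, hU, h1U, hsecU⟩ := hsec
  refine ⟨hL, U, hU, h1U, hproj.isOpenSet_preimage hU, smoothOn_of_smoothAt ?_,
    smoothOn_of_smoothAt fun x hx => ?_⟩
  · rintro ⟨a, u⟩ ⟨-, hu⟩
    refine (hL.mul ((hincl.smoothAt a).comp_of_eq smoothAt_fst rfl)
      ((hsecU.smoothAt hU hu).comp_of_eq smoothAt_snd rfl)).congr ?_
    exact Eventually.of_forall fun p => (incl_mul_sec p.1 p.2).symm
  · have hsec_proj : L.SmoothAt L (fun y => sec S (proj S y)) x :=
      (hsecU.smoothAt hU hx).comp (hproj.smoothAt x)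
    have hincl_ad : L.SmoothAt L (fun y => incl S y.ad) x :=
      (hL.mul smoothAt_id (hL.inv hsec_proj)).congr (Eventually.of_forall fun y =>
        eq_mul_inv_of_mul_eq (incl_mul_sec y.ad y.base))
    exact (hQ.smoothAt_of_hom_comp hL hcoords.fst (fun _ => rfl) hincl_ad).prodMk
      (hproj.smoothAt x)

theorem exists_isNatural (hA : A.IsLieGroup) (hB : B.IsLieGroup)
    (Z : SplitLieSubgroup B (Subgroup.center N)) (hS : S.IsStronglySmooth) :
    ∃ L : LCManifold.{u₁, max u₂ u₃, v} 𝕜 S.GS, IsNatural S Z.quot L := by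
  obtain ⟨L, hL, hto, hfrom⟩ :=
    (isLocallyLieGroup_productManifold Z hA hB hS).exists_isLieGroup
  have hcoords := (Z.quot.prod A).diffeo_comap (coords S)
  exact ⟨L, isNatural_of_smoothAt hA (Z.isLieGroup_quot hB) hL
    (hto.comp_of_eq (hcoords.2.smoothAt (1, 1)) rfl)
    ((hcoords.1.smoothAt 1).comp_of_eq hfrom rfl)⟩

namespace IsNatural

theorem smoothAt_mk (h : IsNatural S Q L) (a : N ⧸ Subgroup.center N) :
    (Q.prod A).SmoothAt L (fun p => (⟨p.1, p.2⟩ : S.GS)) (a, 1) := by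
  obtain ⟨U, hU, h1U, -, hmk, -⟩ := h.local_product
  exact hmk.smoothAt (isOpenSet_univ.prod hU) ⟨mem_univ a, h1U⟩

theorem smoothAt_coords (h : IsNatural S Q L) :
    L.SmoothAt (Q.prod A) (fun x => (x.ad, x.base)) 1 := by
  obtain ⟨U, -, h1U, hU, -, hcoords⟩ := h.local_product
  exact hcoords.smoothAt hU h1U

theorem smoothAt_sec (h : IsNatural S Q L) : A.SmoothAt L (sec S) 1 :=
  (h.smoothAt_mk 1).comp_of_eq (smoothAt_const.prodMk smoothAt_id) rfl

theorem isLieExtension (h : IsNatural S Q L) (hA : A.IsLieGroup) (hQ : Q.IsLieGroup) :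
    IsLieExtension Q L A (incl S) (proj S) :=
  isLieExtension_of_section hQ h.lie hA
    ((h.smoothAt_mk 1).comp_of_eq (smoothAt_id.prodMk smoothAt_const) rfl)
    h.smoothAt_coords.snd range_incl h.smoothAt_sec (fun _ => rfl)
    h.smoothAt_coords.fst fun _ => rfl

theorem smooth_hom {L' : LCManifold.{u₁, max u₂ u₃, v} 𝕜 S'.GS} (hL : IsNatural S Q L)
    (hL' : IsNatural S' Q L') (hQ : Q.IsLieGroup) (φ : S.GS →* S'.GS)
    {h : G → N ⧸ Subgroup.center N} (hh : A.SmoothAt Q h 1)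
    (hφ : ∀ x, φ x = ⟨x.ad * h x.base, x.base⟩) : L.Smooth L' φ := by
  refine hL.lie.smooth_hom hL'.lie φ ?_
  have had : L.SmoothAt Q (fun x => x.ad * h x.base) 1 :=
    hQ.mul hL.smoothAt_coords.fst (hh.comp_of_eq hL.smoothAt_coords.snd rfl)
  exact ((hL'.smoothAt_mk _).comp_of_eq (had.prodMk hL.smoothAt_coords.snd) rfl).congr
    (Eventually.of_forall hφ)

theorem diffeo_refl {L' : LCManifold.{u₁, max u₂ u₃, v} 𝕜 S.GS} (hL : IsNatural S Q L)
    (hL' : IsNatural S Q L') (hQ : Q.IsLieGroup) : L.Diffeo L' (Equiv.refl S.GS) := by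
  have hid (x : S.GS) : MonoidHom.id S.GS x = ⟨x.ad * 1, x.base⟩ := GS.ext (mul_one _).symm rfl
  exact ⟨hL.smooth_hom hL' hQ (MonoidHom.id _) smoothAt_const hid,
    hL'.smooth_hom hL hQ (MonoidHom.id _) smoothAt_const hid⟩

end IsNatural

end Natural

/-- The map is multiplicative because it is compatible with `ρ` and with the projection to `G`. -/
theorem exists_hom_of_conj_mul {h : G → N} (hS' : ∀ g, S'.toFun g = MulAut.conj (h g) * S.toFun g) :
    ∃ φ : S'.GS →* S.GS, ∀ x, φ x = ⟨x.ad * h x.base, x.base⟩ := by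
  let f (x : S'.GS) : S.GS := ⟨x.ad * h x.base, x.base⟩
  have hf (x : S'.GS) : toAut S (f x) = toAut S' x := by
    rw [toAut_apply, toAut_apply, hS', map_mul, mul_assoc]
    rfl
  exact ⟨MonoidHom.mk' f fun x y => ext_toAut rfl (by rw [hf, map_mul, map_mul, hf, hf]),
    fun _ => rfl⟩

namespace IsNatural

variable {Z : SplitLieSubgroup B (Subgroup.center N)} {L : LCManifold.{u₁, max u₂ u₃, v} 𝕜 S.GS}

theorem extensionEquivalent {L' : LCManifold.{u₁, max u₂ u₃, v} 𝕜 S'.GS}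
    (hL : IsNatural S Z.quot L) (hL' : IsNatural S' Z.quot L') (hB : B.IsLieGroup)
    (hSS' : S.Equivalent S') :
    ExtensionEquivalent L' L (incl S') (proj S') (incl S) (proj S) := by
  obtain ⟨h, hh, hS'⟩ := hSS'
  obtain ⟨φ, hφ⟩ := exists_hom_of_conj_mul hS'
  refine ⟨φ, hL'.smooth_hom hL (Z.isLieGroup_quot hB) φ
    ((Z.bundle.smooth_proj.smoothAt _).comp hh.smoothAt) hφ, fun a => ?_, fun x => by rw [hφ]; rfl⟩
  rw [hφ]
  refine GS.ext ?_ rfl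
  change a * (h 1 : N ⧸ Subgroup.center N) = a
  rw [hh.1, QuotientGroup.mk_one, mul_one]

theorem isSmoothAction (hL : IsNatural S Z.quot L) (hB : B.IsLieGroup) :
    IsSmoothAction L B (toAut S) := by
  refine isSmoothAction_of_smoothAt hL.lie (fun ⟨a, g⟩ => ?_) fun n => ?_
  · obtain ⟨n, rfl⟩ := Z.bundle.surjective a
    exact (isLieAut_conj hB n).mul (S.lieAut g)
  · have hcoords := hL.smoothAt_coords.comp_of_eq (smoothAt_fst (B := B) (x := (1, n))) rfl
    have happly : (L.prod B).SmoothAt B (fun p => S.toFun p.1.base p.2) (1, n) :=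
      (S.smoothAt_apply n).comp_of_eq (hcoords.snd.prodMk smoothAt_snd) rfl
    exact ((smooth_conjAd hB Z).smoothAt _).comp (hcoords.fst.prodMk happly)

theorem isSmoothCrossedModule (hL : IsNatural S Z.quot L) (hA : A.IsLieGroup)
    (hB : B.IsLieGroup) : IsSmoothCrossedModule B L (alpha S) (toAut S) := by
  have hext := hL.isLieExtension hA (Z.isLieGroup_quot hB)
  exact {
    lie_source := hB
    lie_target := hL.lie
    smooth := smooth_of_smoothAt fun n =>
      (hext.bundle.smooth_incl.smoothAt _).comp (Z.bundle.smooth_proj.smoothAt n)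
    action := hL.isSmoothAction hB
    equivariant := alpha_toAut
    peiffer := toAut_alpha
    split := hext.exists_splitLieSubgroup_comp (Z.isLieExtension hB) }

end IsNatural
end SmoothOuterAction.GS
end LieGroupGS

theorem mainTheorem6 {𝕜 : Type u₁} [RCLike 𝕜]
    {G : Type u₂} [Group G] (MG : LCManifold.{u₁, u₂, v} 𝕜 G) (hG : MG.IsLieGroup)
    {N : Type u₃} [Group N] (MN : LCManifold.{u₁, u₃, v} 𝕜 N) (hN : MN.IsLieGroup)
    (Z : SplitLieSubgroup MN (Subgroup.center N))
    (S : SmoothOuterAction MG MN) (hS : S.IsStronglySmooth) :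
    -- the quotient manifold structure makes `N_ad = N ⧸ Z(N)` a Lie group
    Z.quot.IsLieGroup ∧
    -- the product of `G^S`, for every `ω` with `δ_S = C_N ∘ ω`
    (∀ ω : G × G → N, (∀ g g', delta S.toFun g g' = MulAut.conj (ω (g, g'))) →
      ∀ (n n' : N) (g g' : G),
        (⟨(n : N ⧸ Subgroup.center N), g⟩ * ⟨(n' : N ⧸ Subgroup.center N), g'⟩ : S.GS) =
          ⟨((n * S.toFun g n' * ω (g, g') : N) : N ⧸ Subgroup.center N), g * g'⟩) ∧
    -- (1) the natural Lie group structure, and the extension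
    ∃ L : LCManifold.{u₁, max u₂ u₃, v} 𝕜 S.GS,
      SmoothOuterAction.GS.IsNatural S Z.quot L ∧
      (∀ L' : LCManifold.{u₁, max u₂ u₃, v} 𝕜 S.GS,
        SmoothOuterAction.GS.IsNatural S Z.quot L' → L.Diffeo L' (Equiv.refl S.GS)) ∧
      IsLieExtension Z.quot L MG
        (SmoothOuterAction.GS.incl S) (SmoothOuterAction.GS.proj S) ∧
      -- its equivalence class depends only on the class of `S`
      (∀ S' : SmoothOuterAction MG MN, S.Equivalent S' →
        S'.IsStronglySmooth ∧
        ∀ L' : LCManifold.{u₁, max u₂ u₃, v} 𝕜 S'.GS,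
          SmoothOuterAction.GS.IsNatural S' Z.quot L' →
          ExtensionEquivalent L' L
            (SmoothOuterAction.GS.incl S') (SmoothOuterAction.GS.proj S')
            (SmoothOuterAction.GS.incl S) (SmoothOuterAction.GS.proj S)) ∧
      -- (2) the smooth action of `G^S` on `N`
      ∃ ρ : S.GS →* MulAut N,
        (∀ (n : N) (g : G),
          ρ ⟨(n : N ⧸ Subgroup.center N), g⟩ = MulAut.conj n * S.toFun g) ∧
        IsSmoothAction L MN ρ ∧
        -- (3) the crossed module, its kernel and its cokernel
        ∃ α : N →* S.GS,
          (∀ n : N, α n = ⟨(n : N ⧸ Subgroup.center N), 1⟩) ∧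
          IsSmoothCrossedModule MN L α ρ ∧
          α.ker = Subgroup.center N ∧
          α.range = (SmoothOuterAction.GS.incl S).range ∧
          (∃ (_ : α.range.Normal) (e : S.GS ⧸ α.range ≃* G),
            (∀ x : S.GS, e (x : S.GS ⧸ α.range) = SmoothOuterAction.GS.proj S x) ∧
            ∀ I : SplitLieSubgroup L α.range, I.quot.Diffeo MG e.toEquiv) ∧
          -- `S` is the outer action obtained from the crossed module and a section `σ`
          ∃ σ : G → S.GS, IsCochain₁ MG L σ ∧
            (∀ g, SmoothOuterAction.GS.proj S (σ g) = g) ∧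
            (∀ g, ρ (σ g) = S.toFun g) ∧
            ∃ ω : G × G → N, IsCochain₂ss MG MN ω ∧
              (∀ g g', α (ω (g, g')) = delta σ g g') ∧
              ∀ g g', delta S.toFun g g' = MulAut.conj (ω (g, g')) := by
  have hZ := Z.isLieGroup_quot hN
  obtain ⟨L, hL⟩ := SmoothOuterAction.GS.exists_isNatural hG hN Z hS
  have hext := hL.isLieExtension hG hZ
  refine ⟨hZ, fun ω hω => SmoothOuterAction.GS.mk_mul_mk hω, L, hL,
    fun L' hL' => hL.diffeo_refl hL' hZ, hext,
    fun S' hS' => ⟨hS'.isStronglySmooth hG hN hS, fun L' hL' => hL.extensionEquivalent hL' hN hS'⟩,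
    SmoothOuterAction.GS.toAut S, SmoothOuterAction.GS.toAut_mk_coe, hL.isSmoothAction hN,
    SmoothOuterAction.GS.alpha S, SmoothOuterAction.GS.alpha_apply,
    hL.isSmoothCrossedModule hG hN, SmoothOuterAction.GS.ker_alpha,
    SmoothOuterAction.GS.range_alpha,
    hext.exists_quotient_equiv
      (SmoothOuterAction.GS.range_alpha.trans SmoothOuterAction.GS.range_incl),
    SmoothOuterAction.GS.sec S, ⟨rfl, hL.smoothAt_sec⟩, fun _ => rfl,
    SmoothOuterAction.GS.toAut_sec, ?_⟩
  obtain ⟨ω, hω, hδ⟩ := hS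
  exact ⟨ω, hω, SmoothOuterAction.GS.alpha_eq_delta_sec hδ, hδ⟩
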